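/- All functions are total functions $f:\mathbb N^k\to\mathbb N$ of arbitrary arity $k\ge 0$. Write $|x|$ for the length of the binary representation of $x\in\mathbb N$ (with $|0|=0$), and $|\vec x|=(|x_1|,\dots,|x_k|)$. A \emph{relation} is a function $r:\mathbb N^m\to\{0,1\}$, $m\ge 0$. For a set $R$ of relations, $\mathbf{FP}(R)$ is the class of functions $f(\vec x)$ computable by a (multi-stack) Turing machine, working on binary representations and with access to an oracle for each $r\in R$ (an oracle call takes one step), in time polynomial in $\sum_i|x_i|$. Put $\mathbf{FP}:=\mathbf{FP}(\emptyset)$, the polynomial-time computable functions. $\mathbf{FP}/\mathit{poly}$ is the class of functions $f(\vec x)$ of $k$ arguments for which there are advice strings $\alpha_{\vec n}$ for $\vec n\in\mathbb N^k$ (identified with the natural numbers of which they are the binary representations), a polynomial $p$ with $|\alpha_{\vec n}|\le p(\vec n)$ for all $\vec n$, and a function $f'(x,\vec x)\in\mathbf{FP}$ such that $$f(\vec x)=f'(\alpha_{|\vec x|},\vec x)\qquad\text{for all }\vec x.$$ Let $\mathbb R$ be the set of all relations whose values depend only on the lengths of their arguments: $$\mathbb R:=\{\,r:\mathbb N^m\to\{0,1\}\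 \mid\ m\ge 0,\ \text{and } |\vec x|=|\vec y|\implies r(\vec x)=r(\vec y)\text{ for all }\vec x,\vec y\,\}.$$ \textbf{Proposition.} $\mathbf{FP}/\mathit{poly}=\mathbf{FP}(\mathbb R)$. -/

import Mathlib

namespace NonUniform

open Turing

/-- The functions of the complexity classes: total functions on natural numbers, of any arity. -/
abbrev NatFun : Type := Σ k : ℕ, ((Fin k → ℕ) → ℕ)

/-- Relations, i.e. functions on natural numbers of any arity with values in `{0, 1}`. -/
abbrev Rel : Type := Σ m : ℕ, ((Fin m → ℕ) → Bool)

/-- The number denoted in binary by a string of bits, least significant bit first. -/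
def value (w : List Bool) : ℕ := w.foldr Nat.bit 0

theorem value_bits (n : ℕ) : value n.bits = n := by
  induction n using Nat.binaryRec' with
  | zero => simp [value]
  | bit b n h ih =>
    rw [Nat.bits_append_bit n b h]
    simpa [value] using congrArg (Nat.bit b) ih

/-- What an oracle machine does at a label: either it executes a statement of a multi-stack Turing
machine (`Turing.TM2`, here with bits as stack symbols), or it asks the oracle for a relation
`r ∈ R` about the numbers written on some of the stacks, and branches on the answer. -/
inductive Instr (R : Set Rel) (K Λ σ : Type) : Type
  | run (q : TM2.Stmt (fun _ : K => Bool) Λ σ)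
  | ask (r : R) (args : Fin r.1.1 → K) (next : Bool → Λ)

/-- Turing machines with `k` inputs and with access to an oracle for each `r ∈ R`. All the data are
finite (so each machine mentions only finitely many of the relations in `R`). -/
structure OracleTM (R : Set Rel) (k : ℕ) where
  /-- index set of the stacks -/
  K : Type
  [decidableEqK : DecidableEq K]
  [finiteK : Finite K]
  /-- labels (control states) -/
  Λ : Type
  [finiteΛ : Finite Λ]
  /-- contents of the finite internal memory -/
  σ : Type
  [finiteσ : Finite σ]
  /-- pairwise distinct stacks that hold the inputs -/
  input : Fin k ↪ K
  /-- the stack that holds the output -/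
  output : K
  /-- the label at which the machine starts -/
  main : Λ
  /-- the initial contents of the internal memory -/
  init : σ
  /-- the program -/
  prog : Λ → Instr R K Λ σ

namespace OracleTM

variable {R : Set Rel} {k : ℕ} (M : OracleTM R k)

instance : DecidableEq M.K := M.decidableEqK

/-- Configurations: the current label (`none` if the machine has halted), the contents of the
internal memory and of the stacks (top symbol first). -/
abbrev Cfg : Type := TM2.Cfg (fun _ : M.K => Bool) M.Λ M.σ

/-- One step of the machine. An oracle call is one step, and leaves the stacks unchanged.
A halted configuration stays as it is. -/
def step (c : M.Cfg) : M.Cfg :=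
  match c.l with
  | none => c
  | some l =>
    match M.prog l with
    | .run q => TM2.stepAux q c.var c.stk
    | .ask r args next => ⟨some (next (r.1.2 fun i => value (c.stk (args i)))), c.var, c.stk⟩

/-- The start on inputs `x`: the binary representations of the `x i` (least significant bit on top,
`0` being represented by the empty string) are on the input stacks; other stacks are empty. -/
noncomputable def start (x : Fin k → ℕ) : M.Cfg where
  l := some M.main
  var := M.init
  stk := Function.extend M.input (fun i => (x i).bits) fun _ => []

/-- On inputs `x` the machine halts after at most `T` steps, with output `y`. -/
def Outputs (x : Fin k → ℕ) (y T : ℕ) : Prop :=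
  ∃ t ≤ T, (M.step^[t] (M.start x)).l = none ∧
    (M.step^[t] (M.start x)).stk M.output = y.bits

end OracleTM

/-- The class `FP(R)`: functions computable by a Turing machine with access to an oracle for
each `r ∈ R` in time polynomial in the total length of the inputs. -/
def FPTime (R : Set Rel) : Set NatFun :=
  {f | ∃ (M : OracleTM R f.1) (p : Polynomial ℕ),
    ∀ x : Fin f.1 → ℕ, M.Outputs x (f.2 x) (p.eval (∑ i, (x i).size))}

/-- The class `FP`: functions computable in polynomial time by a Turing machine (no oracles). -/
def FP : Set NatFun := FPTime ∅

/-- The class `FP/poly`: functions `f` with `f(x) = f'(α_{|x|}, x)` for some `f' ∈ FP` and some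
advice `α_n`, a natural number whose binary length is polynomially bounded in `n`. -/
def FPpoly : Set NatFun :=
  {f | ∃ (α : (Fin f.1 → ℕ) → ℕ) (p : MvPolynomial (Fin f.1) ℕ)
      (f' : (Fin (f.1 + 1) → ℕ) → ℕ),
    (⟨f.1 + 1, f'⟩ : NatFun) ∈ FP ∧
    (∀ n, (α n).size ≤ MvPolynomial.eval n p) ∧
    ∀ x, f.2 x = f' (Fin.cons (α fun i => (x i).size) x)}

/-- The set `ℝ` of the relations whose values depend only on the lengths of their arguments. -/
def lengthRels : Set Rel :=
  {r | ∀ x y : Fin r.1 → ℕ, (∀ i, (x i).size = (y i).size) → r.2 x = r.2 y}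

end NonUniform

/-!
A machine with advice and a machine with oracles for relations on lengths can each simulate the
other.

If `f(x) = f'(α_{|x|}, x)`, the `i`-th bit of the advice is a relation on the lengths of `x` and of
an additional argument of length `i`; so is the comparison of `i` with the length of the advice.
An oracle machine can therefore write down the advice bit by bit and then run the machine for `f'`
(`FPpoly_subset`).

Conversely, let `M` be an oracle machine with running time `p(N)`, where `N` is the total length of
the inputs. Its stacks never exceed a length `B` polynomial in `N`, and it has finitely many oracle
calls, so that all the answers it can get fit into a table of polynomial size, which depends on `N`
only. The table for a call with `m` arguments is nested `m` levels deep, and a block at level `j`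
contains one block for each possible length of the `j`-th argument, each after a separator of that
level. The simulating machine measures the arguments one after the other and each time skips as many
separators as the length of the argument says; after the last one, the next answer symbol is the
right one (`Tabulated.lookup_leads`). Afterwards it restores the table and continues the simulation
of `M` (`Tabulated.sim_reachesIn`).

This machine is only known to halt in time if its first input is a correct table, but a function in
`FP` needs a machine for all inputs. The advice therefore consists of a time bound in unary in
addition to the table, and the simulation is stopped when the time is over. Moreover, leading zeros
are removed from the output. The result is a machine that halts on all inputs in time linear in
their length and computes some function of them (`exists_mem_FP_of_machine`).
-/

namespace NonUniform

open Turing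

/-! ### Binary strings -/

theorem value_append_false (w : List Bool) : value (w ++ [false]) = value w := by
  induction w with
  | nil => rfl
  | cons b w ih => exact congrArg (Nat.bit b) ih

theorem value_append_true_ne_zero (w : List Bool) : value (w ++ [true]) ≠ 0 := by
  induction w with
  | nil => simp [value]
  | cons b w ih =>
    have : value (b :: w ++ [true]) = Nat.bit b (value (w ++ [true])) := rfl
    rw [this]
    exact fun h => ih (Nat.bit_eq_zero_iff.1 h).1

/-- A string whose most significant bit is `1` is the binary representation of its value. -/
theorem bits_value_append_true (w : List Bool) :
    (value (w ++ [true])).bits = w ++ [true] := by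
  induction w with
  | nil => simp [value]
  | cons b w ih =>
    have : value (b :: w ++ [true]) = Nat.bit b (value (w ++ [true])) := rfl
    rw [this, Nat.bits_append_bit _ _ fun h => absurd h (value_append_true_ne_zero w), ih]
    rfl

theorem size_value_append_true (w : List Bool) :
    (value (w ++ [true])).size = w.length + 1 := by
  rw [← Nat.size_eq_bits_len, bits_value_append_true]; simp

theorem size_value_le (w : List Bool) : (value w).size ≤ w.length := by
  induction w using List.reverseRecOn with
  | nil => simp [value]
  | append_singleton w b ih =>
    cases b
    · rw [value_append_false]; simp; omega
    · rw [size_value_append_true]; simp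

theorem size_value_replicate_true (n : ℕ) : (value (List.replicate n true)).size = n := by
  cases n with
  | zero => simp [value]
  | succ n => rw [List.replicate_succ', size_value_append_true, List.length_replicate]

/-! ### Polynomial bounds -/

theorem eval_mono (p : Polynomial ℕ) {a b : ℕ} (h : a ≤ b) : p.eval a ≤ p.eval b := by
  rw [Polynomial.eval_eq_sum_range, Polynomial.eval_eq_sum_range]
  gcongr

/-- A polynomial in several variables is bounded by a polynomial in their sum. -/
theorem exists_polynomial_bound {k : ℕ} (p : MvPolynomial (Fin k) ℕ) :
    ∃ q : Polynomial ℕ, ∀ n, MvPolynomial.eval n p ≤ q.eval (∑ i, n i) := by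
  refine ⟨MvPolynomial.aeval (fun _ => Polynomial.X) p, fun n => ?_⟩
  have h : (MvPolynomial.aeval (fun _ => (Polynomial.X : Polynomial ℕ)) p).eval (∑ i, n i)
      = MvPolynomial.eval (fun _ => ∑ i, n i) p := by
    induction p using MvPolynomial.induction_on with
    | C a => simp
    | add p q hp hq => simp [hp, hq]
    | mul_X p i hp => simp [hp]
  rw [h, MvPolynomial.eval_eq', MvPolynomial.eval_eq']
  gcongr with d hd i
  exact Finset.single_le_sum (f := n) (fun _ _ => Nat.zero_le _) (Finset.mem_univ i)

/-! ### Runs of machines -/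

/-- The iterates of `f` lead from `a` to `b` in at most `n` steps. -/
def ReachesIn {α : Type*} (f : α → α) (n : ℕ) (a b : α) : Prop := ∃ t ≤ n, f^[t] a = b

namespace ReachesIn

variable {α : Type*} {f : α → α} {m n : ℕ} {a b c : α}

theorem refl (f : α → α) (a : α) : ReachesIn f 0 a a := ⟨0, le_rfl, rfl⟩

theorem single (h : f a = b) : ReachesIn f 1 a b := ⟨1, le_rfl, h⟩

theorem mono (h : ReachesIn f m a b) (hmn : m ≤ n) : ReachesIn f n a b :=
  let ⟨t, ht, e⟩ := h; ⟨t, ht.trans hmn, e⟩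

theorem trans (h : ReachesIn f m a b) (h' : ReachesIn f n b c) : ReachesIn f (m + n) a c := by
  obtain ⟨t, ht, rfl⟩ := h
  obtain ⟨u, hu, rfl⟩ := h'
  exact ⟨u + t, by omega, Function.iterate_add_apply f u t a⟩

theorem head (h : f a = b) (h' : ReachesIn f n b c) : ReachesIn f (n + 1) a c :=
  ((single h).trans h').mono (by omega)

end ReachesIn

/-- Statements of a multi-stack machine over the alphabet of bits. -/
abbrev BStmt (K Λ σ : Type) : Type := TM2.Stmt (fun _ : K => Bool) Λ σ

/-- Configurations of a multi-stack machine over the alphabet of bits. -/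
abbrev BCfg (K Λ σ : Type) : Type := TM2.Cfg (fun _ : K => Bool) Λ σ

section

variable {R : Set Rel} {K A Λ Λ' σ τ : Type} [DecidableEq K] [DecidableEq A]

/-- The step function of a program, `OracleTM.step` freed from the bundled machine. -/
def stepWith (prog : Λ → Instr R K Λ σ) (c : BCfg K Λ σ) : BCfg K Λ σ :=
  match c.l with
  | none => c
  | some l =>
    match prog l with
    | .run q => TM2.stepAux q c.var c.stk
    | .ask r args next => ⟨some (next (r.1.2 fun i => value (c.stk (args i)))), c.var, c.stk⟩

theorem step_eq_stepWith {k : ℕ} (M : OracleTM R k) : M.step = stepWith M.prog := by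
  funext ⟨l, v, S⟩
  cases l with
  | none => rfl
  | some l =>
    simp only [OracleTM.step, stepWith]
    cases M.prog l <;> rfl

theorem stepWith_of_halted (prog : Λ → Instr R K Λ σ) {c : BCfg K Λ σ} (h : c.l = none) :
    stepWith prog c = c := by
  simp [stepWith, h]

theorem stepWith_run (prog : Λ → Instr R K Λ σ) {l : Λ} {q : BStmt K Λ σ}
    (h : prog l = .run q) (v : σ) (S : K → List Bool) :
    stepWith prog ⟨some l, v, S⟩ = TM2.stepAux q v S := by
  simp [stepWith, h]

theorem stepWith_ask (prog : Λ → Instr R K Λ σ) {l : Λ} {r : R} {args : Fin r.1.1 → K}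
    {next : Bool → Λ} (h : prog l = .ask r args next) (v : σ) (S : K → List Bool) :
    stepWith prog ⟨some l, v, S⟩ = ⟨some (next (r.1.2 fun i => value (S (args i)))), v, S⟩ := by
  simp [stepWith, h]

theorem iterate_stepWith_of_halted (prog : Λ → Instr R K Λ σ) {c : BCfg K Λ σ}
    (h : c.l = none) (n : ℕ) : (stepWith prog)^[n] c = c :=
  Function.iterate_fixed (stepWith_of_halted prog h) n

theorem iterate_stepWith_eq_of_halted (prog : Λ → Instr R K Λ σ) {c : BCfg K Λ σ} {m n : ℕ}
    (h : ((stepWith prog)^[m] c).l = none) (hmn : m ≤ n) :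
    (stepWith prog)^[n] c = (stepWith prog)^[m] c := by
  obtain ⟨d, rfl⟩ := Nat.exists_eq_add_of_le' hmn
  rw [Function.iterate_add_apply, iterate_stepWith_of_halted prog h]

/-- A statement, executed on a machine with additional stacks, additional memory and additional
labels, which it does not touch; where it halts, the statement `h` is executed instead. -/
def embed (lab : Λ → Λ') (h : BStmt (K ⊕ A) Λ' (σ × τ)) :
    BStmt K Λ σ → BStmt (K ⊕ A) Λ' (σ × τ)
  | .push k f q => .push (.inl k) (fun v => f v.1) (embed lab h q)
  | .peek k f q => .peek (.inl k) (fun v b => (f v.1 b, v.2)) (embed lab h q)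
  | .pop k f q => .pop (.inl k) (fun v b => (f v.1 b, v.2)) (embed lab h q)
  | .load a q => .load (fun v => (a v.1, v.2)) (embed lab h q)
  | .branch f q₁ q₂ => .branch (fun v => f v.1) (embed lab h q₁) (embed lab h q₂)
  | .goto f => .goto fun v => lab (f v.1)
  | .halt => h

/-- Where `q` halts, the embedded statement goes on with `h`; otherwise it does the same as `q`. -/
theorem stepAux_embed (lab : Λ → Λ') (h : BStmt (K ⊕ A) Λ' (σ × τ)) (q : BStmt K Λ σ)
    (v : σ) (w : τ) (S : K → List Bool) (T : A → List Bool) :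
    TM2.stepAux (embed lab h q) (v, w) (Sum.elim S T) =
      match (TM2.stepAux q v S).l with
      | none => TM2.stepAux h ((TM2.stepAux q v S).var, w) (Sum.elim (TM2.stepAux q v S).stk T)
      | some l => ⟨some (lab l), ((TM2.stepAux q v S).var, w),
          Sum.elim (TM2.stepAux q v S).stk T⟩ := by
  induction q generalizing v S with
  | push k f q ih =>
    have := ih v (Function.update S k (f v :: S k))
    rw [← Sum.update_elim_inl] at this
    exact this
  | peek k f q ih => exact ih _ _
  | pop k f q ih =>
    have := ih (f v (S k).head?) (Function.update S k (S k).tail)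
    rw [← Sum.update_elim_inl] at this
    exact this
  | load a q ih => exact ih _ _
  | branch f q₁ q₂ ih₁ ih₂ =>
    cases hf : f v
    · simpa [embed, TM2.stepAux, hf] using ih₂ _ _
    · simpa [embed, TM2.stepAux, hf] using ih₁ _ _
  | goto f => rfl
  | halt => rfl

/-- A bound on the number of symbols a statement pushes. -/
def pushes : BStmt K Λ σ → ℕ
  | .push _ _ q => pushes q + 1
  | .peek _ _ q => pushes q
  | .pop _ _ q => pushes q
  | .load _ q => pushes q
  | .branch _ q₁ q₂ => pushes q₁ + pushes q₂
  | .goto _ => 0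
  | .halt => 0

theorem length_stepAux_le (q : BStmt K Λ σ) (v : σ) (S : K → List Bool) (k : K) :
    ((TM2.stepAux q v S).stk k).length ≤ (S k).length + pushes q := by
  induction q generalizing v S with
  | push k' f q ih =>
    refine (ih _ _).trans ?_
    rcases eq_or_ne k k' with rfl | hk
    · simp [pushes]; omega
    · simp [pushes, hk]
  | peek k' f q ih => exact ih _ _
  | pop k' f q ih =>
    refine (ih _ _).trans ?_
    rcases eq_or_ne k k' with rfl | hk
    · simp [pushes]
    · simp [pushes, hk]
  | load a q ih => exact ih _ _
  | branch f q₁ q₂ ih₁ ih₂ =>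
    cases hf : f v
    · have := ih₂ v S
      simp only [TM2.stepAux, hf, pushes, cond_false]; omega
    · have := ih₁ v S
      simp only [TM2.stepAux, hf, pushes, cond_true]; omega
  | goto f => simp [TM2.stepAux, pushes]
  | halt => simp [TM2.stepAux, pushes]

/-- The stacks of a machine grow at most linearly with time. -/
theorem exists_length_iterate_le [Finite Λ] (prog : Λ → Instr R K Λ σ) :
    ∃ C, ∀ (c : BCfg K Λ σ) (t : ℕ) (k : K),
      (((stepWith prog)^[t] c).stk k).length ≤ (c.stk k).length + C * t := by
  obtain ⟨C, hC⟩ := (Set.finite_range fun l : Λ =>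
    match prog l with
    | .run q => pushes q
    | .ask _ _ _ => 0).bddAbove
  have hstep (c : BCfg K Λ σ) (k : K) :
      ((stepWith prog c).stk k).length ≤ (c.stk k).length + C := by
    rcases c with ⟨_ | l, v, S⟩
    · simp [stepWith]
    · have hl := hC ⟨l, rfl⟩
      cases h : prog l with
      | run q =>
        rw [stepWith_run prog h]
        simp only [h] at hl
        exact (length_stepAux_le q v S k).trans (by simpa using hl)
      | ask r args next => rw [stepWith_ask prog h]; simp
  refine ⟨C, fun c t k => ?_⟩
  induction t with
  | zero => simp
  | succ t ih =>
    rw [Function.iterate_succ_apply']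
    have := hstep ((stepWith prog)^[t] c) k
    rw [mul_add]; omega

end

namespace OracleTM

variable {R : Set Rel} {k : ℕ} (M : OracleTM R k)

theorem outputs_unique {x : Fin k → ℕ} {y y' T T' : ℕ} (h : M.Outputs x y T)
    (h' : M.Outputs x y' T') : y = y' := by
  obtain ⟨t, -, ht, hy⟩ := h
  obtain ⟨t', -, ht', hy'⟩ := h'
  have e : M.step^[t] (M.start x) = M.step^[t'] (M.start x) := by
    rw [step_eq_stepWith] at ht ht' ⊢
    rcases le_total t t' with hle | hle
    · exact (iterate_stepWith_eq_of_halted M.prog ht hle).symm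
    · exact iterate_stepWith_eq_of_halted M.prog ht' hle
  rw [e, hy'] at hy
  rw [← value_bits y, ← hy, value_bits]

theorem length_start_le (x : Fin k → ℕ) (κ : M.K) :
    ((M.start x).stk κ).length ≤ ∑ i, (x i).size := by
  by_cases h : ∃ i, M.input i = κ
  · obtain ⟨i, rfl⟩ := h
    simp only [start, M.input.injective.extend_apply, Nat.size_eq_bits_len]
    exact Finset.single_le_sum (f := fun i => (x i).size) (fun _ _ => Nat.zero_le _)
      (Finset.mem_univ i)
  · simp [start, Function.extend_apply' _ _ _ h]

end OracleTM

/-! ### Advice from relations on lengths -/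

/-- A program without oracles consists of statements only. -/
def Instr.stmt {K Λ σ : Type} : Instr ∅ K Λ σ → BStmt K Λ σ
  | .run q => q
  | .ask r _ _ => absurd r.2 (Set.notMem_empty _)

theorem Instr.run_stmt {K Λ σ : Type} (i : Instr ∅ K Λ σ) : .run i.stmt = i := by
  cases i with
  | run q => rfl
  | ask r _ _ => exact absurd r.2 (Set.notMem_empty _)

/-- The relation "`|z|` is less than the length of the advice for `|x|`" on the tuples `(z, x)`. -/
def adviceLengthRel {k : ℕ} (α : (Fin k → ℕ) → ℕ) : lengthRels :=
  ⟨⟨k + 1, fun y => decide ((y 0).size < (α fun i => (y i.succ).size).size)⟩, by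
    intro x y h
    simp [h]⟩

/-- The relation "the bit at position `|z|` of the advice for `|x|` is `1`" on the tuples
`(z, x)`. -/
def adviceBitRel {k : ℕ} (α : (Fin k → ℕ) → ℕ) : lengthRels :=
  ⟨⟨k + 1, fun y => (α fun i => (y i.succ).size).bits.getD (y 0).size false⟩, by
    intro x y h
    simp [h]⟩

namespace Advised

/-- The control states in which a machine writes down its advice: a unary counter grows to the
length of the advice and shrinks again while the bits of the advice are asked for, from the most
to the least significant one. -/
inductive Phase
  | grow
  | incr
  | shrink
  | query
  | put (b : Bool)
  deriving Fintype

variable {k : ℕ} (M : OracleTM ∅ (k + 1)) (α : (Fin k → ℕ) → ℕ)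

/-- The arguments of the queries: the counter and the inputs. -/
def args : Fin (k + 1) → M.K ⊕ Unit :=
  Fin.cons (.inr ()) fun i => .inl (M.input i.succ)

/-- The program that writes the advice and then runs `M`. -/
def prog : M.Λ ⊕ Phase →
    Instr lengthRels (M.K ⊕ Unit) (M.Λ ⊕ Phase) (M.σ × Option Bool)
  | .inl l => .run (embed .inl .halt (M.prog l).stmt)
  | .inr .grow => .ask (adviceLengthRel α) (args M) fun b => .inr (if b then .incr else .shrink)
  | .inr .incr => .run (.push (.inr ()) (fun _ => true) (.goto fun _ => .inr .grow))
  | .inr .shrink => .run (.pop (.inr ()) (fun v b => (v.1, b))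
      (.goto fun v => if v.2 = none then .inl M.main else .inr .query))
  | .inr .query => .ask (adviceBitRel α) (args M) fun b => .inr (.put b)
  | .inr (.put b) => .run (.push (.inl (M.input 0)) (fun _ => b) (.goto fun _ => .inr .shrink))

/-- The oracle machine that writes the advice on the first input stack of `M` and then runs `M`
on it and its own inputs. -/
def machine : OracleTM lengthRels k where
  K := M.K ⊕ Unit
  decidableEqK := inferInstance
  finiteK := have := M.finiteK; inferInstance
  Λ := M.Λ ⊕ Phase
  finiteΛ := have := M.finiteΛ; inferInstance
  σ := M.σ × Option Bool
  finiteσ := have := M.finiteσ; inferInstance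
  input := ⟨fun i => .inl (M.input i.succ), fun i j h => by simpa using h⟩
  output := .inl M.output
  main := .inr .grow
  init := (M.init, none)
  prog := prog M α

/-- The stacks of `machine` with the string `a` in place of the advice and the number `n` on the
counter. -/
noncomputable def stk (x : Fin k → ℕ) (a : List Bool) (n : ℕ) : M.K ⊕ Unit → List Bool :=
  Sum.elim (Function.extend M.input (Fin.cons a fun i => (x i).bits) fun _ => [])
    fun _ => List.replicate n true

variable (x : Fin k → ℕ) (a : List Bool) (n : ℕ)

theorem start_stk : (machine M α).start x = ⟨some (.inr .grow), (M.init, none), stk M x [] 0⟩ := by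
  have h : Function.extend (fun i : Fin k => (Sum.inl (M.input i.succ) : M.K ⊕ Unit))
      (fun i => (x i).bits) (fun _ => []) = stk M x [] 0 := by
    have hinj : Function.Injective fun i : Fin k => (Sum.inl (M.input i.succ) : M.K ⊕ Unit) :=
      fun i j h => by simpa using h
    funext κ
    by_cases hκ : ∃ i : Fin k, .inl (M.input i.succ) = κ
    · obtain ⟨i, rfl⟩ := hκ
      rw [hinj.extend_apply]
      simp [stk, M.input.injective.extend_apply]
    · rw [Function.extend_apply' _ _ _ hκ]
      rcases κ with κ | κ
      · by_cases h' : ∃ i, M.input i = κ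
        · obtain ⟨i, rfl⟩ := h'
          cases i using Fin.cases with
          | zero => simp [stk, M.input.injective.extend_apply]
          | succ i => exact absurd ⟨i, rfl⟩ hκ
        · simp [stk, Function.extend_apply' _ _ _ h']
      · simp [stk]
  exact congrArg (TM2.Cfg.mk _ _) h

theorem stk_bits (y : ℕ) :
    stk M x y.bits 0 = Sum.elim (M.start (Fin.cons y x)).stk fun _ => [] := by
  have : (Fin.cons y.bits fun i => (x i).bits : Fin (k + 1) → List Bool)
      = fun i => ((Fin.cons y x : Fin (k + 1) → ℕ) i).bits := by
    funext i
    cases i using Fin.cases <;> simp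
  simp [stk, OracleTM.start, this]

theorem update_counter (m : ℕ) :
    Function.update (stk M x a n) (.inr ()) (List.replicate m true) = stk M x a m := by
  rw [stk, Sum.update_elim_inr]
  congr 1

theorem update_advice (a' : List Bool) :
    Function.update (stk M x a n) (.inl (M.input 0)) a' = stk M x a' n := by
  rw [stk, Sum.update_elim_inl]
  congr 1
  funext κ
  rcases eq_or_ne κ (M.input 0) with rfl | hκ
  · simp [M.input.injective.extend_apply]
  · rw [Function.update_of_ne hκ]
    by_cases h' : ∃ i, M.input i = κ
    · obtain ⟨i, rfl⟩ := h'
      cases i using Fin.cases with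
      | zero => exact absurd rfl hκ
      | succ i => simp [M.input.injective.extend_apply]
    · simp [Function.extend_apply' _ _ _ h']

theorem stk_args_zero : stk M x a n (args M 0) = List.replicate n true := rfl

theorem stk_args_succ (i : Fin k) : stk M x a n (args M i.succ) = (x i).bits := by
  simp [stk, args, M.input.injective.extend_apply]

theorem stk_counter : stk M x a n (.inr ()) = List.replicate n true := rfl

theorem stk_advice : stk M x a n (.inl (M.input 0)) = a := by
  simp [stk, M.input.injective.extend_apply]

variable {n}

theorem grow_reachesIn (v : M.σ × Option Bool) (m : ℕ)
    (h : n + m = (α fun i => (x i).size).size) :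
    ReachesIn (stepWith (prog M α)) (2 * m + 1) ⟨some (.inr .grow), v, stk M x [] n⟩
      ⟨some (.inr .shrink), v, stk M x [] (n + m)⟩ := by
  induction m generalizing n with
  | zero =>
    refine ReachesIn.single ?_
    rw [stepWith_ask (prog M α) rfl]
    simp [adviceLengthRel, stk_args_zero, stk_args_succ, value_bits,
      size_value_replicate_true, ← h]
  | succ m ih =>
    have h₁ : stepWith (prog M α) ⟨some (.inr .grow), v, stk M x [] n⟩
        = ⟨some (.inr .incr), v, stk M x [] n⟩ := by
      rw [stepWith_ask (prog M α) rfl]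
      simp [adviceLengthRel, stk_args_zero, stk_args_succ, value_bits,
        size_value_replicate_true, ← h]
    have h₂ : stepWith (prog M α) ⟨some (.inr .incr), v, stk M x [] n⟩
        = ⟨some (.inr .grow), v, stk M x [] (n + 1)⟩ := by
      rw [stepWith_run (prog M α) rfl, ← update_counter M x [] n (n + 1)]
      rfl
    have := ih (n := n + 1) (by omega)
    rw [show n + 1 + m = n + (m + 1) by omega] at this
    exact ((this.head h₂).head h₁).mono (by omega)

theorem shrink_reachesIn (v : M.σ × Option Bool) (h : n ≤ (α fun i => (x i).size).size) :
    ∃ w, ReachesIn (stepWith (prog M α)) (3 * n + 1)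
      ⟨some (.inr .shrink), v, stk M x ((α fun i => (x i).size).bits.drop n) n⟩
      ⟨some (.inl M.main), (v.1, w), stk M x (α fun i => (x i).size).bits 0⟩ := by
  induction n generalizing v with
  | zero =>
    refine ⟨none, ReachesIn.single ?_⟩
    rw [stepWith_run (prog M α) rfl]
    simp only [TM2.stepAux, stk_counter, List.replicate_zero, List.head?_nil, List.tail_nil,
      if_true, List.drop_zero]
    congr 1
    exact update_counter M x _ 0 0
  | succ n ih =>
    obtain ⟨w, hw⟩ := ih (v.1, some true) (by omega)
    refine ⟨w, ?_⟩
    set y := (α fun i => (x i).size) with hy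
    have hlt : n < y.bits.length := by rw [Nat.size_eq_bits_len]; omega
    have h₁ : stepWith (prog M α) ⟨some (.inr .shrink), v, stk M x (y.bits.drop (n + 1)) (n + 1)⟩
        = ⟨some (.inr .query), (v.1, some true), stk M x (y.bits.drop (n + 1)) n⟩ := by
      rw [stepWith_run (prog M α) rfl, ← update_counter M x _ (n + 1) n]
      rfl
    have h₂ : stepWith (prog M α)
          ⟨some (.inr .query), (v.1, some true), stk M x (y.bits.drop (n + 1)) n⟩
        = ⟨some (.inr (.put y.bits[n])), (v.1, some true),
            stk M x (y.bits.drop (n + 1)) n⟩ := by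
      rw [stepWith_ask (prog M α) rfl]
      simp [adviceBitRel, stk_args_zero, stk_args_succ, value_bits,
        size_value_replicate_true, ← hy, hlt]
    have h₃ : stepWith (prog M α)
          ⟨some (.inr (.put y.bits[n])), (v.1, some true), stk M x (y.bits.drop (n + 1)) n⟩
        = ⟨some (.inr .shrink), (v.1, some true), stk M x (y.bits.drop n) n⟩ := by
      rw [stepWith_run (prog M α) rfl, List.drop_eq_getElem_cons hlt,
        ← update_advice M x (y.bits.drop (n + 1)) n (y.bits[n] :: y.bits.drop (n + 1))]
      simp only [TM2.stepAux, stk_advice]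
    exact (((hw.head h₃).head h₂).head h₁).mono (by omega)

/-- Once the advice is written, `M` is simulated step by step. -/
theorem iterate_sim (t : ℕ) (l : Option M.Λ) (v : M.σ) (w : Option Bool) (S : M.K → List Bool) :
    (stepWith (prog M α))^[t] ⟨l.map .inl, (v, w), Sum.elim S fun _ => []⟩ =
      ⟨((stepWith M.prog)^[t] ⟨l, v, S⟩).l.map .inl, (((stepWith M.prog)^[t] ⟨l, v, S⟩).var, w),
        Sum.elim ((stepWith M.prog)^[t] ⟨l, v, S⟩).stk fun _ => []⟩ := by
  induction t generalizing l v S with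
  | zero => rfl
  | succ t ih =>
    rw [Function.iterate_succ_apply, Function.iterate_succ_apply]
    cases l with
    | none => exact ih none v S
    | some l =>
      rw [stepWith_run M.prog (Instr.run_stmt _).symm]
      refine Eq.trans ?_ (ih _ _ _)
      congr 1
      refine (stepWith_run (prog M α) (l := .inl l) rfl _ _).trans ?_
      refine (stepAux_embed _ _ _ _ _ _ _).trans ?_
      cases h : (TM2.stepAux (M.prog l).stmt v S).l <;> rfl

end Advised

theorem FPpoly_subset : FPpoly ⊆ FPTime lengthRels := by
  rintro ⟨k, f⟩ ⟨α, p, f', ⟨M, q, hM⟩, hα, hf⟩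
  obtain ⟨p', hp'⟩ := exists_polynomial_bound p
  refine ⟨Advised.machine M α, 5 * p' + 2 + q.comp (p' + Polynomial.X), fun x => ?_⟩
  dsimp only at M hM hα hf x ⊢
  set y := α fun i => (x i).size with hy
  have hlen : y.size ≤ p'.eval (∑ i, (x i).size) := (hα _).trans (hp' _)
  obtain ⟨t, ht, hhalt, hout⟩ := hM (Fin.cons y x)
  rw [step_eq_stepWith] at hhalt hout
  have hgrow := Advised.grow_reachesIn M α x (M.init, none) (n := 0) y.size (by rw [zero_add])
  rw [zero_add] at hgrow
  obtain ⟨w, hw⟩ := Advised.shrink_reachesIn M α x (n := y.size) (M.init, none) le_rfl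
  rw [List.drop_eq_nil_of_le (by rw [Nat.size_eq_bits_len]), Advised.stk_bits] at hw
  have hrun := Advised.iterate_sim M α t (some M.main) M.init w (M.start (Fin.cons y x)).stk
  have hcfg : (⟨some M.main, M.init, (M.start (Fin.cons y x)).stk⟩ : M.Cfg)
    = M.start (Fin.cons y x) := rfl
  rw [hcfg] at hrun
  obtain ⟨u, hu, e⟩ := (hgrow.trans hw).trans ⟨t, le_rfl, hrun⟩
  have e' := (congrArg (stepWith (Advised.prog M α))^[u] (Advised.start_stk M α x)).trans e
  refine ⟨u, hu.trans ?_, ?_, ?_⟩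
  · have ht' : t ≤ q.eval (p'.eval (∑ i, (x i).size) + ∑ i, (x i).size) := by
      refine ht.trans (eval_mono q ?_)
      simp only [Fin.sum_univ_succ, Fin.cons_zero, Fin.cons_succ]
      omega
    simp only [Polynomial.eval_add, Polynomial.eval_mul, Polynomial.eval_comp, Polynomial.eval_X,
      Polynomial.eval_ofNat]
    omega
  · rw [step_eq_stepWith]
    exact (congrArg TM2.Cfg.l e').trans (congrArg (Option.map Sum.inl) hhalt)
  · rw [step_eq_stepWith]
    refine (congrArg (fun c => c.stk (.inl M.output)) e').trans (hout.trans ?_)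
    rw [← hf]

/-! ### Clocked machines -/

theorem exists_eq_replicate_true_append (w : List Bool) :
    ∃ n r, w = List.replicate n true ++ r ∧ r.head? ≠ some true := by
  induction w with
  | nil => exact ⟨0, [], rfl, by simp⟩
  | cons b w ih =>
    cases b
    · exact ⟨0, false :: w, rfl, by simp⟩
    · obtain ⟨n, r, rfl, hr⟩ := ih
      exact ⟨n + 1, r, rfl, hr⟩

namespace Clocked

/-- The additional stacks of a clocked machine: the remaining time in unary, and a stack for
turning the output around. -/
inductive Aux
  | fuel
  | tmp
  deriving DecidableEq

instance : Fintype Aux := ⟨{.fuel, .tmp}, fun a => by cases a <;> simp⟩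

/-- The additional control states of a clocked machine: `load` moves the leading ones of the first
input to the clock; `unload` turns the output around; `strip seen` turns it back without its
leading zeros, where `seen` tells if a `1` has been met. -/
inductive Phase
  | load
  | unload
  | strip (seen : Bool)
  deriving Fintype

variable {k : ℕ} (M : OracleTM ∅ (k + 1))

/-- The program that runs `M` for as many steps as the clock allows. -/
def prog : M.Λ ⊕ Phase → Instr ∅ (M.K ⊕ Aux) (M.Λ ⊕ Phase) (M.σ × Option Bool)
  | .inl l => .run (.pop (.inr .fuel) (fun v b => (v.1, b))
      (.branch (fun v => v.2 = none) (.goto fun _ => .inr .unload)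
        (embed .inl (.goto fun _ => .inr .unload) (M.prog l).stmt)))
  | .inr .load => .run (.pop (.inl (M.input 0)) (fun v b => (v.1, b))
      (.branch (fun v => v.2 = some true)
        (.push (.inr .fuel) (fun _ => true) (.goto fun _ => .inr .load))
        (.goto fun _ => .inl M.main)))
  | .inr .unload => .run (.pop (.inl M.output) (fun v b => (v.1, b))
      (.branch (fun v => v.2 = none) (.goto fun _ => .inr (.strip false))
        (.push (.inr .tmp) (fun v => v.2.getD false) (.goto fun _ => .inr .unload))))
  | .inr (.strip seen) => .run (.pop (.inr .tmp) (fun v b => (v.1, b))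
      (.branch (fun v => v.2 = none) .halt
        (.branch (fun v => seen || v.2.getD false)
          (.push (.inl M.output) (fun v => v.2.getD false) (.goto fun _ => .inr (.strip true)))
          (.goto fun _ => .inr (.strip false)))))

/-- The machine that reads a time bound in unary from the first input and runs `M` on the rest of
it for that time. It always halts, and always with a binary representation as its output. -/
def machine : OracleTM ∅ (k + 1) where
  K := M.K ⊕ Aux
  decidableEqK := inferInstance
  finiteK := have := M.finiteK; inferInstance
  Λ := M.Λ ⊕ Phase
  finiteΛ := have := M.finiteΛ; inferInstance
  σ := M.σ × Option Bool
  finiteσ := have := M.finiteσ; inferInstance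
  input := M.input.trans .inl
  output := .inl M.output
  main := .inr .load
  init := (M.init, none)
  prog := prog M

/-- The stacks of `machine`, given the stacks of `M`, the clock and the other additional stack. -/
def stk (S : M.K → List Bool) (n : ℕ) (t : List Bool) : M.K ⊕ Aux → List Bool :=
  Sum.elim S fun
    | .fuel => List.replicate n true
    | .tmp => t

variable {M} {S : M.K → List Bool} {n : ℕ} {t : List Bool}

theorem update_inl (κ : M.K) (w : List Bool) :
    Function.update (stk M S n t) (.inl κ) w = stk M (Function.update S κ w) n t :=
  Sum.update_elim_inl

theorem update_fuel (m : ℕ) :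
    Function.update (stk M S n t) (.inr .fuel) (List.replicate m true) = stk M S m t := by
  rw [stk, Sum.update_elim_inr]
  congr 1
  funext a
  cases a <;> rfl

theorem update_tmp (w : List Bool) :
    Function.update (stk M S n t) (.inr .tmp) w = stk M S n w := by
  rw [stk, Sum.update_elim_inr]
  congr 1
  funext a
  cases a <;> rfl

theorem start_eq (z : Fin (k + 1) → ℕ) :
    (machine M).start z = ⟨some (.inr .load), (M.init, none), stk M (M.start z).stk 0 []⟩ := by
  have h : Function.extend (fun i => (Sum.inl (M.input i) : M.K ⊕ Aux))
      (fun i => (z i).bits) (fun _ => []) = stk M (M.start z).stk 0 [] := by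
    have hinj : Function.Injective fun i => (Sum.inl (M.input i) : M.K ⊕ Aux) :=
      fun i j h => by simpa using h
    funext κ
    by_cases hκ : ∃ i, .inl (M.input i) = κ
    · obtain ⟨i, rfl⟩ := hκ
      rw [hinj.extend_apply]
      simp [stk, OracleTM.start, M.input.injective.extend_apply]
    · rw [Function.extend_apply' _ _ _ hκ]
      rcases κ with κ | (_ | _)
      · have h' : ¬ ∃ i, M.input i = κ := fun ⟨i, hi⟩ => hκ ⟨i, congrArg _ hi⟩
        simp [stk, OracleTM.start, Function.extend_apply' _ _ _ h']
      · rfl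
      · rfl
  exact congrArg (TM2.Cfg.mk _ _) h

theorem load_reachesIn (m : ℕ) {r : List Bool} (hr : r.head? ≠ some true)
    (hS : S (M.input 0) = List.replicate m true ++ r) (v : M.σ × Option Bool) :
    ∃ w, ReachesIn (stepWith (prog M)) (m + 1) ⟨some (.inr .load), v, stk M S n t⟩
      ⟨some (.inl M.main), (v.1, w),
        stk M (Function.update S (M.input 0) r.tail) (n + m) t⟩ := by
  induction m generalizing n S v with
  | zero =>
    refine ⟨r.head?, ReachesIn.single ?_⟩
    rw [stepWith_run (prog M) rfl]
    have hS' : stk M S n t (.inl (M.input 0)) = r := hS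
    simp only [TM2.stepAux, hS', hr, decide_false, cond_false, update_inl, add_zero]
  | succ m ih =>
    obtain ⟨w, hw⟩ := ih (n := n + 1) (v := (v.1, some true))
      (S := Function.update S (M.input 0) (List.replicate m true ++ r)) (by simp)
    rw [Function.update_idem, show n + 1 + m = n + (m + 1) by omega] at hw
    refine ⟨w, hw.head ?_⟩
    rw [stepWith_run (prog M) rfl]
    have hS' : stk M S n t (.inl (M.input 0)) = true :: (List.replicate m true ++ r) := hS
    simp only [TM2.stepAux, hS', List.head?_cons, List.tail_cons, decide_true, cond_true,
      update_inl]
    congr 1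
    exact update_fuel (n + 1)

/-- The clocked run of `M` ends, and with the result of `M` if `M` halts in time. -/
theorem sim_reachesIn (n : ℕ) (l : M.Λ) (v : M.σ) (w : Option Bool) (S : M.K → List Bool) :
    ∃ u ≤ n, ∃ (v' : M.σ × Option Bool) (m : ℕ),
      ReachesIn (stepWith (prog M)) (n + 1) ⟨some (.inl l), (v, w), stk M S n t⟩
        ⟨some (.inr .unload), v', stk M ((stepWith M.prog)^[u] ⟨some l, v, S⟩).stk m t⟩ ∧
      ∀ s ≤ n, ((stepWith M.prog)^[s] ⟨some l, v, S⟩).l = none →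
        (stepWith M.prog)^[u] ⟨some l, v, S⟩ = (stepWith M.prog)^[s] ⟨some l, v, S⟩ := by
  induction n generalizing l v w S with
  | zero =>
    refine ⟨0, le_rfl, (v, none), 0, ReachesIn.single ?_, fun s hs _ => ?_⟩
    · rw [stepWith_run (prog M) rfl]
      have hS' : stk M S 0 t (.inr .fuel) = [] := rfl
      simp only [TM2.stepAux, hS', List.head?_nil, List.tail_nil, decide_true, cond_true]
      congr 1
      exact update_fuel 0
    · rw [Nat.le_zero.1 hs]
  | succ n ih =>
    have hM : stepWith M.prog ⟨some l, v, S⟩ = TM2.stepAux (M.prog l).stmt v S :=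
      stepWith_run M.prog (Instr.run_stmt _).symm v S
    have h₁ : stepWith (prog M) ⟨some (.inl l), (v, w), stk M S (n + 1) t⟩ =
        TM2.stepAux (embed .inl (.goto fun _ => .inr .unload) (M.prog l).stmt) (v, some true)
          (stk M S n t) := by
      rw [stepWith_run (prog M) rfl]
      have hS' : stk M S (n + 1) t (.inr .fuel) = true :: List.replicate n true := rfl
      simp only [TM2.stepAux, hS', List.head?_cons, List.tail_cons, reduceCtorEq, decide_false,
        cond_false, update_fuel]
    have h₂ := h₁.trans (stepAux_embed _ _ _ _ _ _ _)
    rw [← hM] at h₂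
    have hs (s : ℕ) (h : ((stepWith M.prog)^[s] ⟨some l, v, S⟩).l = none) : ∃ s', s = s' + 1 := by
      cases s with
      | zero => cases h
      | succ s => exact ⟨s, rfl⟩
    generalize hc : stepWith M.prog ⟨some l, v, S⟩ = c at h₂
    rcases c with ⟨_ | l', v', S'⟩
    · refine ⟨1, by omega, (v', some true), n, (ReachesIn.single ?_).mono (by omega), ?_⟩
      · rw [Function.iterate_one, hc]
        exact h₂
      · intro s _ h
        obtain ⟨s, rfl⟩ := hs s h
        have : (stepWith M.prog)^[1] ⟨some l, v, S⟩ = ⟨none, v', S'⟩ := hc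
        exact (iterate_stepWith_eq_of_halted M.prog (this ▸ rfl) (by omega)).symm
    · obtain ⟨u, hu, v'', m, hr, h⟩ := ih l' v' (some true) S'
      refine ⟨u + 1, by omega, v'', m, ?_, ?_⟩
      · rw [Function.iterate_succ_apply, hc]
        exact hr.head h₂
      · intro s hs' h'
        obtain ⟨s, rfl⟩ := hs s h'
        rw [Function.iterate_succ_apply, hc] at h'
        rw [Function.iterate_succ_apply, Function.iterate_succ_apply, hc]
        exact h s (by omega) h'

theorem unload_reachesIn (v : M.σ × Option Bool) (w : List Bool) (hS : S M.output = w) :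
    ∃ v', ReachesIn (stepWith (prog M)) (w.length + 1) ⟨some (.inr .unload), v, stk M S n t⟩
      ⟨some (.inr (.strip false)), v',
        stk M (Function.update S M.output []) n (w.reverse ++ t)⟩ := by
  have hS' : stk M S n t (.inl M.output) = w := hS
  induction w generalizing S v t with
  | nil =>
    refine ⟨(v.1, none), ReachesIn.single ?_⟩
    rw [stepWith_run (prog M) rfl]
    simp [TM2.stepAux, hS', update_inl]
  | cons b w ih =>
    obtain ⟨v', h⟩ := ih (S := Function.update S M.output w) (t := b :: t) (v.1, some b)
      (by simp) (by simp [stk])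
    refine ⟨v', ?_⟩
    rw [Function.update_idem] at h
    simp only [List.reverse_cons, List.append_assoc, List.singleton_append]
    refine h.head ?_
    rw [stepWith_run (prog M) rfl]
    simp only [TM2.stepAux, hS', List.head?_cons, List.tail_cons, reduceCtorEq, decide_false,
      cond_false, update_inl, Option.getD_some]
    congr 1
    exact update_tmp (b :: t)

theorem strip_true_reachesIn (v : M.σ × Option Bool) :
    ∃ v', ReachesIn (stepWith (prog M)) (t.length + 1) ⟨some (.inr (.strip true)), v, stk M S n t⟩
      ⟨none, v', stk M (Function.update S M.output (t.reverse ++ S M.output)) n []⟩ := by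
  induction t generalizing S v with
  | nil =>
    refine ⟨(v.1, none), ReachesIn.single ?_⟩
    rw [stepWith_run (prog M) rfl]
    have hS' : stk M S n [] (.inr .tmp) = [] := rfl
    simp [TM2.stepAux, hS', update_tmp]
  | cons b t ih =>
    obtain ⟨v', h⟩ := ih (S := Function.update S M.output (b :: S M.output)) (v.1, some b)
    refine ⟨v', ?_⟩
    rw [Function.update_idem, Function.update_self] at h
    simp only [List.reverse_cons, List.append_assoc, List.singleton_append]
    refine h.head ?_
    rw [stepWith_run (prog M) rfl]
    have hS' : stk M S n (b :: t) (.inr .tmp) = b :: t := rfl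
    simp only [TM2.stepAux, hS', List.head?_cons, List.tail_cons, reduceCtorEq, decide_false,
      cond_false, update_tmp, Option.getD_some, Bool.true_or, cond_true]
    congr 1
    exact update_inl _ _

theorem strip_false_reachesIn (v : M.σ × Option Bool) (hS : S M.output = []) :
    ∃ v' S', ReachesIn (stepWith (prog M)) (t.length + 1)
      ⟨some (.inr (.strip false)), v, stk M S n t⟩ ⟨none, v', stk M S' n []⟩ ∧
        S' M.output = (value t.reverse).bits := by
  induction t generalizing v with
  | nil =>
    refine ⟨(v.1, none), S, ReachesIn.single ?_, by simp [hS, value]⟩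
    rw [stepWith_run (prog M) rfl]
    have hS' : stk M S n [] (.inr .tmp) = [] := rfl
    simp [TM2.stepAux, hS', update_tmp]
  | cons b t ih =>
    have hS' : stk M S n (b :: t) (.inr .tmp) = b :: t := rfl
    cases b with
    | false =>
      obtain ⟨v', S', h, hv⟩ := ih (v.1, some false)
      refine ⟨v', S', h.head ?_, by rw [hv, List.reverse_cons, value_append_false]⟩
      rw [stepWith_run (prog M) rfl]
      simp [TM2.stepAux, hS', update_tmp]
    | true =>
      obtain ⟨v', h⟩ := strip_true_reachesIn (t := t) (n := n)
        (S := Function.update S M.output [true]) (v.1, some true)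
      refine ⟨v', _, h.head ?_, by simp [bits_value_append_true]⟩
      rw [stepWith_run (prog M) rfl]
      simp only [TM2.stepAux, hS', List.head?_cons, List.tail_cons, reduceCtorEq, decide_false,
        cond_false, update_tmp, Option.getD_some, Bool.or_true, cond_true]
      congr 1
      rw [← hS]
      exact update_inl _ _

/-- The configuration of `M` in which its clocked simulation starts, when `a` is left of the first
input `z 0`. -/
noncomputable def initCfg (M : OracleTM ∅ (k + 1)) (z : Fin (k + 1) → ℕ) (a : List Bool) :
    BCfg M.K M.Λ M.σ :=
  ⟨some M.main, M.init, Function.update (M.start z).stk (M.input 0) a⟩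

theorem length_initCfg_le (z : Fin (k + 1) → ℕ) {a : List Bool} (ha : a.length ≤ (z 0).size)
    (κ : M.K) : ((initCfg M z a).stk κ).length ≤ ∑ i, (z i).size := by
  rcases eq_or_ne κ (M.input 0) with rfl | hκ
  · simp only [initCfg, Function.update_self]
    exact ha.trans (Finset.single_le_sum (f := fun i => (z i).size) (fun _ _ => Nat.zero_le _)
      (Finset.mem_univ 0))
  · simp only [initCfg, Function.update_of_ne hκ]
    exact M.length_start_le z κ

theorem initCfg_bits (z : Fin (k + 1) → ℕ) (a : ℕ) :
    initCfg M z a.bits = M.start (Fin.cons a (Fin.tail z)) := by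
  refine congrArg (TM2.Cfg.mk _ _) ?_
  funext κ
  rcases eq_or_ne κ (M.input 0) with rfl | hκ
  · simp [OracleTM.start, M.input.injective.extend_apply]
  · rw [Function.update_of_ne hκ]
    by_cases h' : ∃ i, M.input i = κ
    · obtain ⟨i, rfl⟩ := h'
      cases i using Fin.cases with
      | zero => exact absurd rfl hκ
      | succ i => simp [OracleTM.start, M.input.injective.extend_apply, Fin.tail]
    · simp [OracleTM.start, Function.extend_apply' _ _ _ h']

/-- A clocked machine halts on all inputs in linear time. -/
theorem exists_outputs (M : OracleTM ∅ (k + 1)) : ∃ C, ∀ (z : Fin (k + 1) → ℕ) (m : ℕ)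
    (r : List Bool), (z 0).bits = List.replicate m true ++ r → r.head? ≠ some true →
    ∃ y, (machine M).Outputs z y (C * (∑ i, (z i).size) + 4) ∧
      ∀ s ≤ m, ((stepWith M.prog)^[s] (initCfg M z r.tail)).l = none →
        y = value (((stepWith M.prog)^[s] (initCfg M z r.tail)).stk M.output) := by
  have := M.finiteΛ
  obtain ⟨C, hC⟩ := exists_length_iterate_le M.prog
  refine ⟨4 + 2 * C, fun z m r hz hr => ?_⟩
  have hlen : m + r.length = (z 0).size := by
    rw [← Nat.size_eq_bits_len, hz]; simp
  have hm : m ≤ ∑ i, (z i).size :=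
    (show m ≤ (z 0).size by omega).trans (Finset.single_le_sum (f := fun i => (z i).size)
      (fun _ _ => Nat.zero_le _) (Finset.mem_univ 0))
  have hS : (M.start z).stk (M.input 0) = List.replicate m true ++ r := by
    simpa [OracleTM.start, M.input.injective.extend_apply] using hz
  obtain ⟨w, hload⟩ := load_reachesIn (n := 0) (t := []) m hr hS (M.init, none)
  rw [zero_add] at hload
  obtain ⟨u, hu, v', n', hsim, hres⟩ := sim_reachesIn (t := []) m M.main M.init w
    (Function.update (M.start z).stk (M.input 0) r.tail)
  rw [← initCfg] at hsim
  generalize hc : (stepWith M.prog)^[u] (initCfg M z r.tail) = c at hsim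
  obtain ⟨v₁, hunload⟩ := unload_reachesIn (n := n') (t := []) v' (c.stk M.output) rfl
  obtain ⟨v₂, S', hstrip, hout⟩ := strip_false_reachesIn (n := n')
    (t := (c.stk M.output).reverse ++ []) v₁ (S := Function.update c.stk M.output [])
    (Function.update_self ..)
  obtain ⟨T, hT, e⟩ := ((hload.trans hsim).trans hunload).trans hstrip
  have e' := (congrArg (stepWith (prog M))^[T] (start_eq z)).trans e
  refine ⟨value (c.stk M.output), ⟨T, hT.trans ?_, ?_, ?_⟩, fun s hs hl => ?_⟩
  · have h₁ := hC (initCfg M z r.tail) u M.output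
    rw [hc] at h₁
    have h₂ := length_initCfg_le (M := M) z (a := r.tail) (by simp; omega) M.output
    have h₃ : C * u ≤ C * ∑ i, (z i).size := Nat.mul_le_mul_left _ (hu.trans hm)
    simp only [List.append_nil, List.length_reverse, add_mul, mul_assoc]
    omega
  · rw [step_eq_stepWith]
    exact congrArg TM2.Cfg.l e'
  · rw [step_eq_stepWith]
    refine (congrArg (fun c => c.stk (.inl M.output)) e').trans (hout.trans ?_)
    simp
  · rw [← hc]
    exact congrArg (fun c => value (c.stk M.output)) (hres s hs hl)

end Clocked

/-- A machine that works properly for some first inputs only can be used for all of them, if these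
come with a bound on the running time. -/
theorem exists_mem_FP_of_machine {k : ℕ} (M : OracleTM ∅ (k + 1)) :
    ∃ f' : (Fin (k + 1) → ℕ) → ℕ, (⟨k + 1, f'⟩ : NatFun) ∈ FP ∧
      ∀ (w : List Bool) (x : Fin k → ℕ) (y T : ℕ),
        M.Outputs (Fin.cons (value (w ++ [true])) x) y T →
        f' (Fin.cons (value (List.replicate T true ++ false :: w ++ [true])) x) = y := by
  obtain ⟨C, hC⟩ := Clocked.exists_outputs M
  have hall (z : Fin (k + 1) → ℕ) :
      ∃ y, (Clocked.machine M).Outputs z y (C * (∑ i, (z i).size) + 4) := by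
    obtain ⟨n, r, hn, hr⟩ := exists_eq_replicate_true_append (z 0).bits
    obtain ⟨y, hy, -⟩ := hC z n r hn hr
    exact ⟨y, hy⟩
  choose f' hf' using hall
  refine ⟨f', ⟨Clocked.machine M, Polynomial.C C * Polynomial.X + 4, fun z => ?_⟩, ?_⟩
  · simpa using hf' z
  · rintro w x y T ⟨t, ht, hl, hy⟩
    set z : Fin (k + 1) → ℕ :=
      Fin.cons (value (List.replicate T true ++ false :: w ++ [true])) x with hz
    -- The bit `0` after the time bound stops the loading of the clock.
    obtain ⟨y', hy', h⟩ := hC z T (false :: (w ++ [true]))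
      (by simp only [hz, Fin.cons_zero, bits_value_append_true]; simp) (by simp)
    rw [OracleTM.outputs_unique _ (hf' z) hy']
    have hinit : Clocked.initCfg M z (w ++ [true]) =
        M.start (Fin.cons (value (w ++ [true])) x) := by
      have := Clocked.initCfg_bits (M := M) z (value (w ++ [true]))
      rwa [bits_value_append_true] at this
    rw [step_eq_stepWith] at hl hy
    rw [List.tail_cons, hinit] at h
    rw [h t ht hl, hy, value_bits]

/-! ### Relations on lengths from advice -/

namespace Instr

variable {K Λ σ : Type}

/-- The stacks an instruction asks about. -/
def args {R : Set Rel} : Instr R K Λ σ → List K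
  | .run _ => []
  | .ask _ args _ => List.ofFn args

/-- The label after an oracle call with answer `b`, and `l` for other instructions. -/
def next {R : Set Rel} (l : Λ) (b : Bool) : Instr R K Λ σ → Λ
  | .run _ => l
  | .ask _ _ next => next b

/-- The answer of the oracle, given the lengths `ns` of the numbers it is asked about: since the
relation depends on lengths only, it is evaluated at some numbers of these lengths. -/
def answer (ns : List ℕ) : Instr lengthRels K Λ σ → Bool
  | .run _ => false
  | .ask r _ _ => r.1.2 fun i => value (List.replicate (ns.getD i 0) true)

theorem answer_ask (r : lengthRels) (args : Fin r.1.1 → K) (next : Bool → Λ)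
    (S : K → List Bool) :
    answer ((List.ofFn args).map fun κ => (value (S κ)).size)
      (.ask r args next : Instr lengthRels K Λ σ) = r.1.2 fun i => value (S (args i)) := by
  refine r.2 _ _ fun i => ?_
  simp [size_value_replicate_true]

end Instr

namespace Tabulated

variable {k : ℕ} (M : OracleTM lengthRels k)

/-- Queries in progress: the label of the oracle call, and the arguments still to be treated. -/
abbrev Pending : Type := {p : M.Λ × List M.K // p.2 <:+ (M.prog p.1).args}

instance : Finite (Pending M) := by
  have := M.finiteΛ
  have h : {p : M.Λ × List M.K | p.2 <:+ (M.prog p.1).args} ⊆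
      ⋃ l, (fun a => (l, a)) '' {a | a ∈ (M.prog l).args.tails} := by
    rintro ⟨l, a⟩ h
    exact Set.mem_iUnion.2 ⟨l, a, (List.mem_tails _ _).2 h, rfl⟩
  exact ((Set.finite_iUnion fun l => (List.finite_toSet _).image _).subset h).to_subtype

/-- The symbols of the table: separators, one for each query in progress, and answers. -/
abbrev Sym : Type := Pending M ⊕ M.Λ × Bool

variable {M} in
/-- The query in progress after the treatment of one argument. -/
def Pending.tail (p : Pending M) : Pending M :=
  ⟨(p.1.1, p.1.2.tail), (List.tail_suffix _).trans p.2⟩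

/-- All symbols in some order. -/
noncomputable def symbols : List (Sym M) :=
  have := M.finiteΛ
  (Finite.exists_univ_list (Sym M)).choose

variable {M} in
theorem mem_symbols (s : Sym M) : s ∈ symbols M :=
  have := M.finiteΛ
  (Finite.exists_univ_list (Sym M)).choose_spec.2 s

/-- All labels in some order. -/
noncomputable def labels : List M.Λ :=
  have := M.finiteΛ
  (Finite.exists_univ_list M.Λ).choose

variable {M} in
theorem mem_labels (l : M.Λ) : l ∈ labels M :=
  have := M.finiteΛ
  (Finite.exists_univ_list M.Λ).choose_spec.2 l

open Classical in
variable {M} in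
/-- A symbol is encoded in binary by its characteristic function. -/
noncomputable def code (s : Sym M) : List Bool := (symbols M).map fun s' => decide (s' = s)

variable {M} in
/-- The binary encoding of a string of symbols. -/
noncomputable def encode (w : List (Sym M)) : List Bool := w.flatMap code

theorem encode_cons (s : Sym M) (w : List (Sym M)) : encode (s :: w) = code s ++ encode w :=
  List.flatMap_cons

theorem encode_append (v w : List (Sym M)) : encode (v ++ w) = encode v ++ encode w :=
  List.flatMap_append

theorem length_encode (w : List (Sym M)) :
    (encode w).length = w.length * (symbols M).length := by
  induction w with
  | nil => simp [encode]
  | cons s w ih => rw [encode_cons, List.length_append, ih, code]; simp; ring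

/-- The table of the answers to the oracle call at `l`, for arguments of length at most `B`, where
`ns` are the lengths of the arguments treated before. The entries for the values of the next
argument's length follow each other, each after a separator. -/
def table (B : ℕ) (l : M.Λ) :
    (as : List M.K) → as <:+ (M.prog l).args → List ℕ → List (Sym M)
  | [], _, ns => [.inr (l, (M.prog l).answer ns)]
  | κ :: as, h, ns => (List.range (B + 1)).flatMap fun n =>
      .inl ⟨(l, κ :: as), h⟩ :: table B l as ((List.suffix_cons κ as).trans h) (ns ++ [n])

/-- The table of the answers to all oracle calls. -/
noncomputable def fullTable (B : ℕ) : List (Sym M) :=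
  (labels M).flatMap fun l => table M B l (M.prog l).args (List.suffix_refl _) []

/-- The length of a table as a polynomial in the bound on the lengths of the arguments. -/
noncomputable def tablePoly : List M.K → Polynomial ℕ
  | [] => 1
  | _ :: as => (Polynomial.X + 1) * (tablePoly as + 1)

/-- The length of the full table as a polynomial in the bound on the lengths of the arguments. -/
noncomputable def fullTablePoly : Polynomial ℕ :=
  ((labels M).map fun l => tablePoly M (M.prog l).args).sum

theorem length_table (B : ℕ) (l : M.Λ) (as : List M.K) (h : as <:+ (M.prog l).args)
    (ns : List ℕ) : (table M B l as h ns).length = (tablePoly M as).eval B := by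
  induction as generalizing ns with
  | nil => simp [table, tablePoly]
  | cons κ as ih => simp [table, tablePoly, ih, List.length_flatMap]

theorem length_fullTable (B : ℕ) : (fullTable M B).length = (fullTablePoly M).eval B := by
  simp only [fullTable, fullTablePoly, List.length_flatMap, length_table]
  induction labels M with
  | nil => simp
  | cons l ls ih => simp [ih]

variable {M}

/-- The oracle call a symbol belongs to. -/
def Sym.label : Sym M → M.Λ := Sum.elim (fun p => p.1.1) Prod.fst

theorem label_of_mem_table {B : ℕ} {l : M.Λ} {as : List M.K} {h : as <:+ (M.prog l).args}
    {ns : List ℕ} {s : Sym M} (hs : s ∈ table M B l as h ns) : Sym.label s = l := by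
  induction as generalizing ns with
  | nil =>
    obtain rfl := List.mem_singleton.1 hs
    rfl
  | cons κ as ih =>
    obtain ⟨n, -, hs⟩ := List.mem_flatMap.1 hs
    rcases List.mem_cons.1 hs with rfl | hs
    · rfl
    · exact ih hs

theorem length_le_of_mem_table {B : ℕ} {l : M.Λ} {as : List M.K} {h : as <:+ (M.prog l).args}
    {ns : List ℕ} {p : Pending M} (hp : .inl p ∈ table M B l as h ns) :
    p.1.2.length ≤ as.length := by
  induction as generalizing ns with
  | nil => simp [table] at hp
  | cons κ as ih =>
    obtain ⟨n, -, hp⟩ := List.mem_flatMap.1 hp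
    rcases List.mem_cons.1 hp with hp | hp
    · obtain rfl := Sum.inl.inj hp
      exact le_rfl
    · exact (ih hp).trans (by simp)

variable (M)

/-- The additional stacks: the table, the part of it that has been read, a stack for turning
strings around, and a counter for the length of an argument. -/
inductive Aux
  | table
  | read
  | tmp
  | count
  deriving DecidableEq

instance : Fintype Aux := ⟨{.table, .read, .tmp, .count}, fun a => by cases a <;> simp⟩

/-- The additional control states. In `unload p` the next argument of the query `p` is moved to
`tmp`, or the table is searched for the answer if no argument is left. In `reload p seen` it is
moved back and its length is counted, where `seen` tells if a `1` has been met. In `scan p` as many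
separators as the counter says are searched. In `restore l b` the table is restored. -/
inductive Phase
  | unload (p : Pending M)
  | reload (p : Pending M) (seen : Bool)
  | scan (p : Pending M)
  | restore (l : M.Λ) (b : Bool)

instance : Finite (Phase M) := by
  have := M.finiteΛ
  refine Finite.of_surjective
    (Sum.elim (Sum.elim Phase.unload fun x : Pending M × Bool => .reload x.1 x.2)
      (Sum.elim .scan fun x : M.Λ × Bool => .restore x.1 x.2)) ?_
  rintro (p | ⟨p, b⟩ | p | ⟨l, b⟩)
  · exact ⟨.inl (.inl p), rfl⟩
  · exact ⟨.inl (.inr (p, b)), rfl⟩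
  · exact ⟨.inr (.inl p), rfl⟩
  · exact ⟨.inr (.inr (l, b)), rfl⟩

/-- The internal memory: that of `M`, the bit and the symbol read last. -/
abbrev Mem : Type := M.σ × (Option Bool × Option (Sym M))

/-- Statements of the table machine. -/
abbrev Stmt : Type := BStmt (M.K ⊕ Aux) (M.Λ ⊕ Phase M) (Mem M)

variable {M}

/-- Keep the bit read last. -/
def setBit (v : Mem M) (b : Option Bool) : Mem M := (v.1, b, v.2.2)

/-- Read a bit of the table for each symbol of the list `w`, keep the symbol with bit `1`, and
continue with `q`. For the list of all symbols this decodes one symbol in a single step. -/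
def readBits (q : Stmt M) : List (Sym M) → Stmt M
  | [] => q
  | s :: w => .pop (.inr .table) (fun v b => (v.1, b, if b = some true then some s else v.2.2))
      (.push (.inr .read) (fun v => v.2.1.getD false) (readBits q w))

open Classical in
/-- The program that answers the oracle calls of `M` from a table. -/
noncomputable def prog :
    M.Λ ⊕ Phase M → Instr ∅ (M.K ⊕ Aux) (M.Λ ⊕ Phase M) (Mem M)
  | .inl l => .run <|
      match M.prog l with
      | .run q => embed .inl .halt q
      | .ask _ _ _ => .goto fun _ => .inr (.unload ⟨(l, (M.prog l).args), List.suffix_refl _⟩)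
  | .inr (.unload p) => .run <|
      match p.1.2 with
      | [] => readBits (.goto fun v => .inr <|
          if v.2.2 = some (.inr (p.1.1, true)) then .restore p.1.1 true
          else if v.2.2 = some (.inr (p.1.1, false)) then .restore p.1.1 false
          else .unload p) (symbols M)
      | κ :: _ => .pop (.inl κ) setBit
          (.branch (fun v => v.2.1 = none) (.goto fun _ => .inr (.reload p false))
            (.push (.inr .tmp) (fun v => v.2.1.getD false) (.goto fun _ => .inr (.unload p))))
  | .inr (.reload p seen) => .run <|
      .pop (.inr .tmp) setBit
        (.branch (fun v => v.2.1 = none) (.goto fun _ => .inr (.scan p))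
          (.push (.inl (p.1.2.headD M.output)) (fun v => v.2.1.getD false)
            (.branch (fun v => seen || v.2.1.getD false)
              (.push (.inr .count) (fun _ => true) (.goto fun _ => .inr (.reload p true)))
              (.goto fun _ => .inr (.reload p false)))))
  | .inr (.scan p) => .run <|
      readBits (.branch (fun v => v.2.2 = some (.inl p))
        (.pop (.inr .count) setBit
          (.goto fun v => .inr (if v.2.1 = none then .unload p.tail else .scan p)))
        (.goto fun _ => .inr (.scan p))) (symbols M)
  | .inr (.restore l b) => .run <|
      .pop (.inr .read) setBit
        (.branch (fun v => v.2.1 = none) (.goto fun _ => .inl ((M.prog l).next l b))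
          (.push (.inr .table) (fun v => v.2.1.getD false) (.goto fun _ => .inr (.restore l b))))

variable (M) in
/-- The machine that simulates `M`, with a table of the answers of the oracles as first input. -/
noncomputable def machine : OracleTM ∅ (k + 1) where
  K := M.K ⊕ Aux
  decidableEqK := inferInstance
  finiteK := have := M.finiteK; inferInstance
  Λ := M.Λ ⊕ Phase M
  finiteΛ := have := M.finiteΛ; inferInstance
  σ := Mem M
  finiteσ := have := M.finiteΛ; have := M.finiteσ; inferInstance
  input := ⟨Fin.cons (.inr .table) fun i => .inl (M.input i), by
    rw [Fin.cons_injective_iff]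
    exact ⟨by simp, fun i j h => by simpa using h⟩⟩
  output := .inl M.output
  main := .inl M.main
  init := (M.init, none, none)
  prog := prog

variable (M) in
/-- The stacks of `machine`, given the stacks of `M` and the additional ones. -/
def stk (S : M.K → List Bool) (a r t : List Bool) (n : ℕ) : M.K ⊕ Aux → List Bool :=
  Sum.elim S fun
    | .table => a
    | .read => r
    | .tmp => t
    | .count => List.replicate n true

variable {S : M.K → List Bool} {a r t : List Bool} {n : ℕ}

theorem update_inl (κ : M.K) (w : List Bool) :
    Function.update (stk M S a r t n) (.inl κ) w = stk M (Function.update S κ w) a r t n :=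
  Sum.update_elim_inl

theorem update_table (w : List Bool) :
    Function.update (stk M S a r t n) (.inr .table) w = stk M S w r t n := by
  rw [stk, Sum.update_elim_inr]
  congr 1
  funext a
  cases a <;> rfl

theorem update_read (w : List Bool) :
    Function.update (stk M S a r t n) (.inr .read) w = stk M S a w t n := by
  rw [stk, Sum.update_elim_inr]
  congr 1
  funext a
  cases a <;> rfl

theorem update_tmp (w : List Bool) :
    Function.update (stk M S a r t n) (.inr .tmp) w = stk M S a r w n := by
  rw [stk, Sum.update_elim_inr]
  congr 1
  funext a
  cases a <;> rfl

theorem update_count (m : ℕ) :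
    Function.update (stk M S a r t n) (.inr .count) (List.replicate m true) =
      stk M S a r t m := by
  rw [stk, Sum.update_elim_inr]
  congr 1
  funext a
  cases a <;> rfl

theorem stk_inl (κ : M.K) : stk M S a r t n (.inl κ) = S κ := rfl

theorem stk_table : stk M S a r t n (.inr .table) = a := rfl

theorem stk_read : stk M S a r t n (.inr .read) = r := rfl

theorem stk_tmp : stk M S a r t n (.inr .tmp) = t := rfl

theorem stk_count : stk M S a r t n (.inr .count) = List.replicate n true := rfl

theorem start_eq (y : ℕ) (x : Fin k → ℕ) :
    (machine M).start (Fin.cons y x) =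
      ⟨some (.inl M.main), (M.init, none, none), stk M (M.start x).stk y.bits [] [] 0⟩ := by
  refine congrArg (TM2.Cfg.mk _ _) ?_
  have hinj := (machine M).input.injective
  funext κ
  by_cases hκ : ∃ i, (machine M).input i = κ
  · obtain ⟨i, rfl⟩ := hκ
    rw [hinj.extend_apply]
    cases i using Fin.cases with
    | zero => rfl
    | succ i =>
      have : (machine M).input i.succ = .inl (M.input i) := rfl
      rw [this, stk_inl]
      simp [OracleTM.start, M.input.injective.extend_apply]
  · rw [Function.extend_apply' _ _ _ hκ]
    rcases κ with κ | (_ | _ | _ | _)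
    · have h' : ¬ ∃ i, M.input i = κ := fun ⟨i, hi⟩ => hκ ⟨i.succ, congrArg Sum.inl hi⟩
      rw [stk_inl]
      simp [OracleTM.start, Function.extend_apply' _ _ _ h']
    · exact absurd ⟨0, rfl⟩ hκ
    all_goals rfl

/-- From label `l` and stacks `T` the machine reaches `l'` and `T'` in at most `n` steps, without
changing the memory of `M`. -/
def Leads (n : ℕ) (l : M.Λ ⊕ Phase M) (T : M.K ⊕ Aux → List Bool)
    (l' : M.Λ ⊕ Phase M) (T' : M.K ⊕ Aux → List Bool) : Prop :=
  ∀ v w, ∃ w', ReachesIn (stepWith prog) n ⟨some l, (v, w), T⟩ ⟨some l', (v, w'), T'⟩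

theorem Leads.refl (l : M.Λ ⊕ Phase M) (T : M.K ⊕ Aux → List Bool) : Leads 0 l T l T :=
  fun _ w => ⟨w, ReachesIn.refl _ _⟩

theorem Leads.trans {m n : ℕ} {l l' l'' : M.Λ ⊕ Phase M} {T T' T'' : M.K ⊕ Aux → List Bool}
    (h : Leads m l T l' T') (h' : Leads n l' T' l'' T'') : Leads (m + n) l T l'' T'' := by
  intro v w
  obtain ⟨w', h⟩ := h v w
  obtain ⟨w'', h'⟩ := h' v w'
  exact ⟨w'', h.trans h'⟩

theorem Leads.mono {m n : ℕ} {l l' : M.Λ ⊕ Phase M} {T T' : M.K ⊕ Aux → List Bool}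
    (h : Leads m l T l' T') (hmn : m ≤ n) : Leads n l T l' T' := fun v w =>
  let ⟨w', h⟩ := h v w; ⟨w', h.mono hmn⟩

theorem Leads.single {l l' : M.Λ ⊕ Phase M} {q : Stmt M} (hq : prog l = .run q)
    {T T' : M.K ⊕ Aux → List Bool}
    (h : ∀ v w, ∃ w', TM2.stepAux q (v, w) T = ⟨some l', (v, w'), T'⟩) : Leads 1 l T l' T' := by
  intro v w
  obtain ⟨w', h⟩ := h v w
  exact ⟨w', ReachesIn.single ((stepWith_run prog hq _ _).trans h)⟩

open Classical in
theorem stepAux_readBits (q : Stmt M) (s : Sym M) (w : List (Sym M)) (v : Mem M) :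
    ∃ b, TM2.stepAux (readBits q w) v
        (stk M S ((w.map fun s' => decide (s' = s)) ++ a) r t n) =
      TM2.stepAux q (v.1, b, if s ∈ w then some s else v.2.2)
        (stk M S a ((w.map fun s' => decide (s' = s)).reverse ++ r) t n) := by
  induction w generalizing v r with
  | nil => exact ⟨v.2.1, by simp [readBits]⟩
  | cons s' w ih =>
    obtain ⟨b, hb⟩ := ih (r := decide (s' = s) :: r)
      (v.1, some (decide (s' = s)), if s' = s then some s' else v.2.2)
    refine ⟨b, ?_⟩
    simp only [readBits, TM2.stepAux, stk_table, stk_read, update_table, update_read,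
      List.map_cons, List.cons_append, List.head?_cons, List.tail_cons, Option.getD_some,
      Option.some.injEq, decide_eq_true_eq, List.reverse_cons, List.append_assoc,
      List.nil_append]
    rw [hb]
    congr 3
    by_cases h : s' = s
    · subst h; simp
    · simp [h, Ne.symm h]

theorem stepAux_read (q : Stmt M) (s : Sym M) (v : Mem M) :
    ∃ b, TM2.stepAux (readBits q (symbols M)) v (stk M S (code s ++ a) r t n) =
      TM2.stepAux q (v.1, b, some s) (stk M S a ((code s).reverse ++ r) t n) := by
  obtain ⟨b, hb⟩ := stepAux_readBits (S := S) (a := a) (r := r) (t := t) (n := n) q s (symbols M) v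
  rw [if_pos (mem_symbols s)] at hb
  exact ⟨b, hb⟩

theorem unload_leads {p : Pending M} {κ : M.K} {as : List M.K} (hp : p.1.2 = κ :: as)
    (w : List Bool) (hS : S κ = w) :
    Leads (w.length + 1) (.inr (.unload p)) (stk M S a r t n) (.inr (.reload p false))
      (stk M (Function.update S κ []) a r (w.reverse ++ t) n) := by
  have hprog : prog (.inr (.unload p)) = .run (.pop (.inl κ) setBit
      (.branch (fun v => v.2.1 = none) (.goto fun _ => .inr (.reload p false))
        (.push (.inr .tmp) (fun v => v.2.1.getD false) (.goto fun _ => .inr (.unload p))))) := by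
    simp only [prog, hp]
  induction w generalizing S t with
  | nil =>
    refine Leads.single hprog fun v w => ⟨(none, w.2), ?_⟩
    simp [TM2.stepAux, setBit, stk_inl, hS, update_inl]
  | cons b w ih =>
    have h := ih (S := Function.update S κ w) (t := b :: t) (by simp)
    rw [Function.update_idem] at h
    simp only [List.reverse_cons, List.append_assoc, List.singleton_append]
    refine ((Leads.single hprog fun v w => ⟨(some b, w.2), ?_⟩).trans h).mono
      (by simp only [List.length_cons]; omega)
    simp [TM2.stepAux, setBit, stk_inl, stk_tmp, hS, update_inl, update_tmp]

theorem reload_true_leads {p : Pending M} {κ : M.K} {as : List M.K} (hp : p.1.2 = κ :: as) :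
    Leads (t.length + 1) (.inr (.reload p true)) (stk M S a r t n) (.inr (.scan p))
      (stk M (Function.update S κ (t.reverse ++ S κ)) a r [] (n + t.length)) := by
  induction t generalizing S n with
  | nil =>
    refine Leads.single rfl fun v w => ⟨(none, w.2), ?_⟩
    simp [TM2.stepAux, setBit, stk_tmp, update_tmp]
  | cons b t ih =>
    have h := ih (S := Function.update S κ (b :: S κ)) (n := n + 1)
    rw [Function.update_idem, Function.update_self] at h
    simp only [List.reverse_cons, List.append_assoc, List.singleton_append, List.length_cons]
    rw [show n + 1 + t.length = n + (t.length + 1) by omega] at h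
    refine ((Leads.single rfl fun v w => ⟨(some b, w.2), ?_⟩).trans h).mono (by omega)
    simp only [TM2.stepAux, setBit, stk_tmp, stk_inl, stk_count, update_inl, update_tmp, hp,
      List.headD_cons, List.head?_cons, List.tail_cons, reduceCtorEq, decide_false, cond_false,
      Bool.true_or, cond_true, Option.getD_some]
    congr 1
    exact update_count (n + 1)

theorem reload_false_leads {p : Pending M} {κ : M.K} {as : List M.K} (hp : p.1.2 = κ :: as) :
    Leads (t.length + 1) (.inr (.reload p false)) (stk M S a r t 0) (.inr (.scan p))
      (stk M (Function.update S κ (t.reverse ++ S κ)) a r [] (value t.reverse).size) := by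
  induction t generalizing S with
  | nil =>
    refine Leads.single rfl fun v w => ⟨(none, w.2), ?_⟩
    simp [TM2.stepAux, setBit, stk_tmp, update_tmp, value]
  | cons b t ih =>
    simp only [List.reverse_cons, List.append_assoc, List.singleton_append, List.length_cons]
    cases b with
    | false =>
      have h := ih (S := Function.update S κ (false :: S κ))
      rw [Function.update_idem, Function.update_self] at h
      rw [value_append_false]
      refine ((Leads.single rfl fun v w => ⟨(some false, w.2), ?_⟩).trans h).mono (by omega)
      simp [TM2.stepAux, setBit, stk_tmp, stk_inl, update_inl, update_tmp, hp]
    | true =>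
      have h := reload_true_leads (S := Function.update S κ (true :: S κ)) (a := a) (r := r)
        (t := t) (n := 1) hp
      rw [Function.update_idem, Function.update_self] at h
      rw [size_value_append_true, List.length_reverse, add_comm t.length 1]
      refine ((Leads.single rfl fun v w => ⟨(some true, w.2), ?_⟩).trans h).mono (by omega)
      simp only [TM2.stepAux, setBit, stk_tmp, stk_inl, stk_count, update_inl, update_tmp, hp,
        List.headD_cons, List.head?_cons, List.tail_cons, reduceCtorEq, decide_false, cond_false,
        Bool.or_true, cond_true, Option.getD_some]
      congr 1
      exact update_count 1

/-- The length of the next argument is counted, and the argument is restored. -/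
theorem measure_leads {p : Pending M} {κ : M.K} {as : List M.K} (hp : p.1.2 = κ :: as) :
    Leads (2 * (S κ).length + 2) (.inr (.unload p)) (stk M S a r [] 0) (.inr (.scan p))
      (stk M S a r [] (value (S κ)).size) := by
  have h := reload_false_leads (S := Function.update S κ []) (a := a) (r := r)
    (t := (S κ).reverse ++ []) hp
  have h' := (unload_leads (S := S) (a := a) (r := r) (t := []) (n := 0) hp (S κ) rfl).trans h
  simp only [List.append_nil, List.reverse_reverse, Function.update_self, Function.update_idem,
    Function.update_eq_self, List.length_reverse] at h'
  exact h'.mono (by omega)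

theorem scan_skip_leads {p : Pending M} (w : List (Sym M)) (hw : .inl p ∉ w) :
    Leads w.length (.inr (.scan p)) (stk M S (encode w ++ a) r t n) (.inr (.scan p))
      (stk M S a ((encode w).reverse ++ r) t n) := by
  induction w generalizing r with
  | nil => exact Leads.refl _ _
  | cons s w ih =>
    rw [List.mem_cons, not_or] at hw
    have h := ih (r := (code s).reverse ++ r) hw.2
    rw [encode_cons, List.reverse_append, List.append_assoc, List.append_assoc]
    refine ((Leads.single rfl fun v w' => ?_).trans h).mono
      (by simp only [List.length_cons]; omega)
    obtain ⟨b, hb⟩ := stepAux_read (S := S) (a := encode w ++ a) (r := r) (t := t) (n := n)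
      _ s (v, w')
    refine ⟨(b, some s), hb.trans ?_⟩
    simp [TM2.stepAux, Ne.symm hw.1]

theorem scan_succ_leads {p : Pending M} :
    Leads 1 (.inr (.scan p)) (stk M S (code (.inl p) ++ a) r t (n + 1)) (.inr (.scan p))
      (stk M S a ((code (.inl p)).reverse ++ r) t n) := by
  refine Leads.single rfl fun v w => ?_
  obtain ⟨b, hb⟩ := stepAux_read (S := S) (a := a) (r := r) (t := t) (n := n + 1)
      _ (.inl p) (v, w)
  refine ⟨(some true, some (.inl p)), hb.trans ?_⟩
  simp [TM2.stepAux, setBit, stk_count, update_count, List.replicate_succ]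

theorem scan_zero_leads {p : Pending M} :
    Leads 1 (.inr (.scan p)) (stk M S (code (.inl p) ++ a) r t 0) (.inr (.unload p.tail))
      (stk M S a ((code (.inl p)).reverse ++ r) t 0) := by
  refine Leads.single rfl fun v w => ?_
  obtain ⟨b, hb⟩ := stepAux_read (S := S) (a := a) (r := r) (t := t) (n := 0)
      _ (.inl p) (v, w)
  refine ⟨(none, some (.inl p)), hb.trans ?_⟩
  have h := update_count (M := M) (S := S) (a := a) (r := (code (.inl p)).reverse ++ r)
    (t := t) (n := 0) 0
  rw [List.replicate_zero] at h
  simp [TM2.stepAux, setBit, stk_count, h]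

/-- The search for a block in a sequence of blocks of length `L`. -/
theorem scan_blocks_leads {p : Pending M} (F : ℕ → List (Sym M)) (hF : ∀ n, .inl p ∉ F n)
    {L : ℕ} (hL : ∀ n, (F n).length = L) (ns : List ℕ) (c : ℕ) (hc : c < ns.length) :
    ∃ a' r', Leads (c * (1 + L) + 1) (.inr (.scan p))
        (stk M S (encode (ns.flatMap fun n => .inl p :: F n) ++ a) r [] c)
        (.inr (.unload p.tail)) (stk M S (encode (F ns[c]) ++ a') r' [] 0) ∧
      r'.reverse ++ (encode (F ns[c]) ++ a') =
        r.reverse ++ (encode (ns.flatMap fun n => .inl p :: F n) ++ a) := by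
  induction ns generalizing c r with
  | nil => simp at hc
  | cons m ns ih =>
    simp only [List.flatMap_cons, List.cons_append, encode_cons, encode_append, List.append_assoc]
    cases c with
    | zero =>
      exact ⟨_, _, scan_zero_leads.mono (by omega), by simp⟩
    | succ c =>
      obtain ⟨a', r', h, e⟩ := ih
        (r := (encode (F m)).reverse ++ ((code (.inl p)).reverse ++ r)) c (by simpa using hc)
      refine ⟨a', r', ((scan_succ_leads.trans (scan_skip_leads (F m) (hF m))).trans h).mono ?_, ?_⟩
      · rw [hL]; ring_nf; omega
      · simp only [List.getElem_cons_succ]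
        rw [e]
        simp

theorem answer_skip_leads {p : Pending M} (hp : p.1.2 = []) (w : List (Sym M))
    (hw : ∀ s ∈ w, Sym.label s ≠ p.1.1) :
    Leads w.length (.inr (.unload p)) (stk M S (encode w ++ a) r t n) (.inr (.unload p))
      (stk M S a ((encode w).reverse ++ r) t n) := by
  induction w generalizing r with
  | nil => exact Leads.refl _ _
  | cons s w ih =>
    rw [List.forall_mem_cons] at hw
    have h := ih (r := (code s).reverse ++ r) hw.2
    rw [encode_cons, List.reverse_append, List.append_assoc, List.append_assoc]
    refine ((Leads.single (by simp only [prog, hp]; rfl) fun v w' => ?_).trans h).mono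
      (by simp only [List.length_cons]; omega)
    obtain ⟨b, hb⟩ := stepAux_read (S := S) (a := encode w ++ a) (r := r) (t := t) (n := n)
      _ s (v, w')
    refine ⟨(b, some s), hb.trans ?_⟩
    have hs (b : Bool) : s ≠ .inr (p.1.1, b) := fun h => hw.1 (by rw [h]; rfl)
    simp [TM2.stepAux, hs]

theorem answer_leads {p : Pending M} (hp : p.1.2 = []) (b : Bool) :
    Leads 1 (.inr (.unload p)) (stk M S (code (.inr (p.1.1, b)) ++ a) r t n)
      (.inr (.restore p.1.1 b)) (stk M S a ((code (.inr (p.1.1, b))).reverse ++ r) t n) := by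
  refine Leads.single (by simp only [prog, hp]; rfl) fun v w => ?_
  obtain ⟨b', hb⟩ := stepAux_read (S := S) (a := a) (r := r) (t := t) (n := n)
    _ (.inr (p.1.1, b)) (v, w)
  refine ⟨(b', some (.inr (p.1.1, b))), hb.trans ?_⟩
  cases b <;> simp [TM2.stepAux]

/-- The lookup in a table that may be preceded by tables `u` for other oracle calls. What has been
read and what is left make up the original content of the table stack, so that it can be
restored. -/
theorem lookup_leads {B : ℕ} (hB : ∀ κ, (S κ).length ≤ B) (l : M.Λ) (as : List M.K)
    (h : as <:+ (M.prog l).args) (ns : List ℕ) (u : List (Sym M))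
    (hu : ∀ s ∈ u, Sym.label s ≠ l) (a r : List Bool) :
    ∃ a' r', Leads (u.length + (tablePoly M as).eval B + as.length * (2 * B + 2))
        (.inr (.unload ⟨(l, as), h⟩)) (stk M S (encode (u ++ table M B l as h ns) ++ a) r [] 0)
        (.inr (.restore l ((M.prog l).answer (ns ++ as.map fun κ => (value (S κ)).size))))
        (stk M S a' r' [] 0) ∧
      r'.reverse ++ a' = r.reverse ++ (encode (u ++ table M B l as h ns) ++ a) := by
  induction as generalizing ns u a r with
  | nil =>
    have h₁ := answer_skip_leads (S := S) (a := encode (table M B l [] h ns) ++ a) (r := r)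
      (t := []) (n := 0) (p := ⟨(l, []), h⟩) rfl u hu
    have h₂ := answer_leads (S := S) (a := a) (r := (encode u).reverse ++ r)
      (t := []) (n := 0) (p := ⟨(l, []), h⟩) rfl ((M.prog l).answer ns)
    have e : encode (table M B l [] h ns) = code (.inr (l, (M.prog l).answer ns)) := by
      simp [table, encode]
    rw [e] at h₁
    refine ⟨a, (code (.inr (l, (M.prog l).answer ns))).reverse ++ ((encode u).reverse ++ r), ?_, ?_⟩
    · rw [encode_append, List.append_assoc, e, List.map_nil, List.append_nil]
      exact (h₁.trans h₂).mono (by simp [tablePoly])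
    · rw [encode_append, e]
      simp
  | cons κ as ih =>
    have hc : (value (S κ)).size < (List.range (B + 1)).length := by
      rw [List.length_range]
      exact Nat.lt_succ_of_le ((size_value_le _).trans (hB κ))
    set c := (value (S κ)).size with hc'
    set p : Pending M := ⟨(l, κ :: as), h⟩ with hp
    have h' := (List.suffix_cons κ as).trans h
    have h₁ := measure_leads (S := S) (a := encode (u ++ table M B l (κ :: as) h ns) ++ a)
      (r := r) (p := p) rfl
    have h₂ := scan_skip_leads (S := S) (a := encode (table M B l (κ :: as) h ns) ++ a)
      (r := r) (t := []) (n := c) (p := p) u fun hmem => hu _ hmem rfl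
    obtain ⟨a₁, r₁, h₃, e₁⟩ := scan_blocks_leads (S := S) (a := a) (r := (encode u).reverse ++ r)
      (p := p) (fun n => table M B l as h' (ns ++ [n]))
      (fun n hmem => by
        have := length_le_of_mem_table hmem
        simp [hp] at this)
      (fun n => length_table M B l as h' (ns ++ [n])) (List.range (B + 1)) c hc
    rw [List.getElem_range] at h₃ e₁
    obtain ⟨a₂, r₂, h₄, e₂⟩ := ih h' (ns ++ [c]) [] (by simp) a₁ r₁
    rw [List.nil_append] at h₄ e₂
    refine ⟨a₂, r₂, ?_, ?_⟩
    · rw [List.map_cons, ← hc', List.append_cons ns c]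
      rw [encode_append, List.append_assoc] at h₁ ⊢
      refine (((h₁.trans h₂).trans h₃).trans h₄).mono ?_
      have hcB : c ≤ B := by simpa using Nat.lt_succ_iff.1 (by simpa using hc)
      have hmul : c * (1 + (tablePoly M as).eval B) ≤ B * (1 + (tablePoly M as).eval B) :=
        Nat.mul_le_mul_right _ hcB
      have hlen := hB κ
      simp only [tablePoly, Polynomial.eval_mul, Polynomial.eval_add, Polynomial.eval_X,
        Polynomial.eval_one, List.length_nil, List.length_cons]
      -- `c` blocks are skipped and one is entered, out of `B + 1` blocks of equal length.
      nlinarith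
    · rw [e₂, e₁, encode_append]
      simp [table, hp]

theorem restore_leads (l : M.Λ) (b : Bool) :
    Leads (r.length + 1) (.inr (.restore l b)) (stk M S a r t n)
      (.inl ((M.prog l).next l b)) (stk M S (r.reverse ++ a) [] t n) := by
  induction r generalizing a with
  | nil =>
    refine Leads.single rfl fun v w => ⟨(none, w.2), ?_⟩
    simp [TM2.stepAux, setBit, stk_read, update_read]
  | cons c r ih =>
    simp only [List.reverse_cons, List.append_assoc, List.singleton_append, List.length_cons]
    refine ((Leads.single rfl fun v w => ⟨(some c, w.2), ?_⟩).trans (ih (a := c :: a))).mono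
      (by omega)
    simp [TM2.stepAux, setBit, stk_read, stk_table, update_read, update_table]

variable (M) in
/-- The content of the table stack. It ends in `1` in order to be the binary representation of a
number. -/
noncomputable def advice (B : ℕ) : List Bool := encode (fullTable M B) ++ [true]

variable (M) in
/-- A bound on the time for the simulation of one step of `M`. -/
noncomputable def stepPoly : Polynomial ℕ :=
  fullTablePoly M * (((symbols M).length + 1 : ℕ) : Polynomial ℕ) +
    (((labels M).map fun l => (M.prog l).args.length).sum : Polynomial ℕ) *
      (2 * Polynomial.X + 2) + 3

theorem one_le_eval_stepPoly (B : ℕ) : 1 ≤ (stepPoly M).eval B := by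
  simp [stepPoly]

/-- An oracle call of `M` is simulated by a lookup in the table. -/
theorem ask_leads {B : ℕ} (hB : ∀ κ, (S κ).length ≤ B) {l : M.Λ} {ρ : lengthRels}
    {args : Fin ρ.1.1 → M.K} {next : Bool → M.Λ} (hl : M.prog l = .ask ρ args next) :
    Leads ((stepPoly M).eval B) (.inl l) (stk M S (advice M B) [] [] 0)
      (.inl (next (ρ.1.2 fun i => value (S (args i))))) (stk M S (advice M B) [] [] 0) := by
  have h₁ : Leads 1 (.inl l) (stk M S (advice M B) [] [] 0)
      (.inr (.unload ⟨(l, (M.prog l).args), List.suffix_refl _⟩))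
      (stk M S (advice M B) [] [] 0) := by
    refine Leads.single (q := .goto fun _ => _) ?_ fun v w => ⟨w, rfl⟩
    simp only [prog]
    split
    · next q hq => rw [hl] at hq; cases hq
    · rfl
  -- The tables for the labels `ls` before `l` are skipped, as they contain no symbols for `l`.
  obtain ⟨ls, ls', hls, hnot⟩ := List.eq_append_cons_of_mem (mem_labels l)
  set u : List (Sym M) :=
    ls.flatMap fun l => table M B l (M.prog l).args (List.suffix_refl _) [] with hu
  set u' : List (Sym M) :=
    ls'.flatMap fun l => table M B l (M.prog l).args (List.suffix_refl _) [] with hu'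
  have hfull : fullTable M B =
      (u ++ table M B l (M.prog l).args (List.suffix_refl _) []) ++ u' := by
    rw [fullTable, hls]
    simp [hu, hu']
  obtain ⟨a', r', h₂, e⟩ := lookup_leads hB l (M.prog l).args (List.suffix_refl _) [] u
    (fun s hs => by
      obtain ⟨l', hl', hs⟩ := List.mem_flatMap.1 hs
      rw [label_of_mem_table hs]
      exact fun h => hnot (h ▸ hl')) (encode u' ++ [true]) []
  rw [List.reverse_nil, List.nil_append, ← List.append_assoc, ← encode_append, ← hfull,
    ← advice] at e
  rw [← List.append_assoc, ← encode_append, ← hfull, ← advice] at h₂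
  have h₃ := (h₁.trans h₂).trans (restore_leads (S := S) (a := a') (r := r') (t := []) (n := 0)
    l _)
  rw [e, List.nil_append] at h₃
  have hnext : (M.prog l).next l ((M.prog l).answer ((M.prog l).args.map
      fun κ => (value (S κ)).size)) = next (ρ.1.2 fun i => value (S (args i))) := by
    rw [hl, ← Instr.answer_ask ρ args next]
    rfl
  rw [hnext] at h₃
  refine h₃.mono ?_
  have hlen := congrArg List.length hfull
  rw [List.length_append, List.length_append, length_table, length_fullTable] at hlen
  have hr : r'.length ≤ (fullTablePoly M).eval B * (symbols M).length + 1 := by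
    have := congrArg List.length e
    simp only [List.length_append, List.length_reverse, advice, length_encode, length_fullTable,
      List.length_singleton] at this
    omega
  have hargs : (M.prog l).args.length ≤
      ((labels M).map fun l => (M.prog l).args.length).sum :=
    List.single_le_sum (by simp) _ (List.mem_map_of_mem (mem_labels l))
  have hmul := Nat.mul_le_mul_right (2 * B + 2) hargs
  rw [mul_add, mul_add] at hmul
  simp only [stepPoly, Polynomial.eval_add, Polynomial.eval_mul, Polynomial.eval_natCast,
    Polynomial.eval_X, Polynomial.eval_ofNat, mul_add, Nat.cast_id, mul_one]
  omega

/-- The simulation of `M`, as long as the stacks are not higher than the table allows. -/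
theorem sim_reachesIn {B : ℕ} (c : M.Cfg) (w : Option Bool × Option (Sym M)) (t : ℕ)
    (hB : ∀ s ≤ t, ∀ κ, (((stepWith M.prog)^[s] c).stk κ).length ≤ B) :
    ∃ w', ReachesIn (stepWith prog) (t * (stepPoly M).eval B)
      ⟨c.l.map .inl, (c.var, w), stk M c.stk (advice M B) [] [] 0⟩
      ⟨((stepWith M.prog)^[t] c).l.map .inl, (((stepWith M.prog)^[t] c).var, w'),
        stk M ((stepWith M.prog)^[t] c).stk (advice M B) [] [] 0⟩ := by
  induction t with
  | zero =>
    rw [zero_mul]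
    exact ⟨w, ReachesIn.refl _ _⟩
  | succ t ih =>
    obtain ⟨w', h⟩ := ih fun s hs => hB s (by omega)
    have hB' := hB t (by omega)
    rw [Function.iterate_succ_apply']
    generalize (stepWith M.prog)^[t] c = d at h hB'
    rw [Nat.succ_mul]
    rcases d with ⟨_ | l, v, S⟩
    · exact ⟨w', h.mono (by omega)⟩
    · cases hl : M.prog l with
      | run q =>
        rw [stepWith_run M.prog hl]
        refine ⟨w', (h.trans (ReachesIn.single ?_)).mono
          (Nat.add_le_add_left (one_le_eval_stepPoly B) _)⟩
        have hprog : prog (.inl l) = .run (embed .inl .halt q : Stmt M) := by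
          simp only [prog]
          split
          · next q' hq => rw [hl] at hq; cases hq; rfl
          · next hq => rw [hl] at hq; cases hq
        refine (stepWith_run prog hprog _ _).trans ((stepAux_embed _ _ _ _ _ _ _).trans ?_)
        cases h : (TM2.stepAux q v S).l <;> rfl
      | ask ρ args next =>
        rw [stepWith_ask M.prog hl]
        obtain ⟨w'', h'⟩ := ask_leads hB' hl v w'
        exact ⟨w'', h.trans h'⟩

end Tabulated

open Tabulated in
theorem FPTime_lengthRels_subset : FPTime lengthRels ⊆ FPpoly := by
  rintro ⟨k, f⟩ ⟨M, p, hM⟩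
  dsimp only at M hM
  have := M.finiteΛ
  obtain ⟨C, hC⟩ := exists_length_iterate_le M.prog
  obtain ⟨f', hf', h⟩ := exists_mem_FP_of_machine (machine M)
  -- `b` bounds the height of the stacks of `M`, and `F` the time for the simulation of `M`.
  set b : Polynomial ℕ := Polynomial.X + (C : Polynomial ℕ) * p with hb
  set F : Polynomial ℕ := p * (stepPoly M).comp b with hF
  let α (N : ℕ) : ℕ := value (List.replicate (F.eval N) true ++
    false :: encode (fullTable M (b.eval N)) ++ [true])
  let P : Polynomial ℕ := F + (fullTablePoly M).comp b * ((symbols M).length : Polynomial ℕ) + 2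
  refine ⟨fun n => α (∑ i, n i), Polynomial.aeval (∑ i, MvPolynomial.X i) P, f', hf',
    fun n => ?_, fun x => ?_⟩
  · have heval (Q : Polynomial ℕ) :
        MvPolynomial.eval n (Polynomial.aeval (∑ i, MvPolynomial.X i) Q) = Q.eval (∑ i, n i) := by
      induction Q using Polynomial.induction_on' with
      | add Q Q' h h' => simp [h, h']
      | monomial m a => simp [Polynomial.aeval_monomial]
    rw [heval]
    simp only [α, size_value_append_true]
    simp [P, length_encode, length_fullTable]
    omega
  · refine (h _ x _ _ ?_).symm
    set N := ∑ i, (x i).size with hN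
    obtain ⟨t, ht, hl, hy⟩ := hM x
    rw [step_eq_stepWith] at hl hy
    obtain ⟨w, u, hu, e⟩ := sim_reachesIn (B := b.eval N) (M.start x) (none, none) t
      fun s hs κ => by
        have h₁ := hC (M.start x) s κ
        have h₂ := M.length_start_le x κ
        rw [← hN] at h₂
        have h₃ : C * s ≤ C * p.eval N := Nat.mul_le_mul_left _ (hs.trans ht)
        simp only [hb, Polynomial.eval_add, Polynomial.eval_X, Polynomial.eval_mul,
          Polynomial.eval_natCast, Nat.cast_id]
        omega
    have e' := (congrArg (stepWith (machine M).prog)^[u]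
      (start_eq (M := M) (value (advice M (b.eval N))) x)).trans
      ((by rw [advice, bits_value_append_true]; rfl : _ = _).trans e)
    refine ⟨u, hu.trans ?_, ?_, ?_⟩
    · rw [hF, Polynomial.eval_mul, Polynomial.eval_comp]
      exact Nat.mul_le_mul_right _ ht
    · rw [step_eq_stepWith]
      exact (congrArg TM2.Cfg.l e').trans (congrArg (Option.map Sum.inl) hl)
    · rw [step_eq_stepWith]
      exact (congrArg (fun c => c.stk (.inl M.output)) e').trans hy

end NonUniform

theorem mainTheorem3 : NonUniform.FPpoly = NonUniform.FPTime NonUniform.lengthRels :=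
  Set.Subset.antisymm NonUniform.FPpoly_subset NonUniform.FPTime_lengthRels_subset
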